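/- Let $p$ be a prime. **Partial groups.** A partial group is a non-empty set $\mathcal L$ with a set $\mathbf D$ of words in $\mathcal L$, a product $\Pi\colon\mathbf D\to\mathcal L$ and an involutory map $g\mapsto g^{-1}$ on $\mathcal L$ (extended to words by $(g_1,\dots,g_k)^{-1}=(g_k^{-1},\dots,g_1^{-1})$) such that: $\mathbf D$ contains all words of length one, and $\Pi$ is the identity on them; $u\circ v\in\mathbf D$ implies $u,v\in\mathbf D$; $u\circ v\circ w\in\mathbf D$ implies $u\circ(\Pi(v))\circ w\in\mathbf D$ and $\Pi(u\circ v\circ w)=\Pi(u\circ(\Pi(v))\circ w)$; and $w\in\mathbf D$ implies $w^{-1}\circ w\in\mathbf D$ and $\Pi(w^{-1}\circ w)=\mathbf 1:=\Pi(\emptyset)$. For $g\in\mathcal L$ put $\mathbf D(g)=\{x:(g^{-1},x,g)\in\mathbf D\}$ and $x^g=\Pi(g^{-1},x,g)$ for $x\in\mathbf D(g)$; for $H\subseteq\mathbf D(g)$ put $H^g=\{h^g:h\in H\}$. Let $N_{\mathcal L}(H)$ be the set of $g$ with $H\subseteq\mathbf D(g)$ and $H^g=H$, and $C_{\mathcal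 L}(H)$ the set of $g$ with $H\subseteq\mathbf D(g)$ and $h^g=h$ for all $h\in H$. A partial subgroup is a non-empty subset closed under inversion and under all defined products; it is a subgroup if all products of its elements are defined (it is then a group), and a partial subgroup $\mathcal N$ is partial normal if $n^g\in\mathcal N$ whenever $n\in\mathcal N$, $g\in\mathcal L$ and $n\in\mathbf D(g)$. A $p$-subgroup is a subgroup whose order is a power of $p$. A projection of partial groups is a map $\beta\colon\mathcal L\to\mathcal L'$ such that, applied letter by letter, it maps $\mathbf D$ onto $\mathbf D'$, and $\Pi(w)^\beta=\Pi'(w^\beta)$ for all $w\in\mathbf D$. **Localities.** A triple $(\mathcal L,\Delta,S)$ is a locality if $\mathcal L$ is a finite partial group, $S$ is maximal among the $p$-subgroups of $\mathcal L$, and $\Delta$ is a non-empty set of subgroups of $S$ such that: a word $(f_1,\dots,f_n)$ lies in $\mathbf D$ if and only if there are $P_0,\dots,P_n\in\Delta$ with $P_{i-1}\subseteq\mathbf D(f_i)$ and $P_{i-1}^{f_i}=P_i$ for all $i$; every subgroup of $S$ containing a member of $\Delta$ lies in $\Delta$; and $P^g\in\Delta$ whenever $P\in\Delta$, $g\in\mathcal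 L$, $P\subseteq\mathbf D(g)$ and $P^g\subseteq S$. For $P\in\Delta$ the set $N_{\mathcal L}(P)$ is a subgroup of $\mathcal L$. The fusion system $\mathcal F_S(\mathcal L)$ is the fusion system over $S$ generated by the conjugation maps $x\mapsto x^g$ ($g\in\mathcal L$) between subgroups of $S$. A partial normal $p'$-subgroup of $\mathcal L$ is a partial normal subgroup $\mathcal N$ with $\mathcal N\cap S=\{\mathbf 1\}$. For a partial normal subgroup $\mathcal N$, let $\mathcal L/\mathcal N$ be the set of those cosets $\mathcal Nf=\{\Pi(n,f):n\in\mathcal N,\ (n,f)\in\mathbf D\}$ ($f\in\mathcal L$) that are maximal under inclusion among all such cosets. **Signalizer functors.** A signalizer functor of a locality $(\mathcal L,\Delta,S)$ on objects assigns to each $P\in\Delta$ a normal subgroup $\Theta(P)$ of $N_{\mathcal L}(P)$ of order prime to $p$ such that * $\Theta(P)^g=\Theta(P^g)$ for all $P\in\Delta$ and $g\in\mathcal L$ with $P\subseteq\mathbf D(g)$ and $P^g\subseteq S$; * $\Theta(P)\cap C_{\mathcal L}(Q)=\Theta(Q)$ for all $P,Q\in\Delta$ with $P\le Q$. **Proposition.**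 Let $\Theta$ be a signalizer functor of a locality $(\mathcal L,\Delta,S)$ on objects. Then $$\widehat\Theta:=\bigcup_{P\in\Delta}\Theta(P)$$ is a partial normal $p'$-subgroup of $\mathcal L$. Every element of $\mathcal L$ lies in exactly one maximal coset of $\widehat\Theta$, and $\mathcal L/\widehat\Theta$ carries exactly one partial group structure for which the resulting map $\rho\colon\mathcal L\to\mathcal L/\widehat\Theta$ is a projection of partial groups. The map $\rho$ restricts to an isomorphism of groups $S\to S^\rho$. Upon identifying $S$ with $S^\rho$ (and thus each $P\in\Delta$ with $P^\rho$) along it, the following hold. * (a) $(\mathcal L/\widehat\Theta,\Delta,S)$ is a locality, and $\mathcal F_S(\mathcal L/\widehat\Theta)=\mathcal F_S(\mathcal L)$. * (b) For each $P\in\Delta$, the map $\rho$ restricts to a group homomorphism $N_{\mathcal L}(P)\to N_{\mathcal L/\widehat\Theta}(P)$ which has kernel $\Theta(P)$ and induces an isomorphism $N_{\mathcal L}(P)/\Theta(P)\cong N_{\mathcal L/\widehat\Theta}(P)$. -/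

import Mathlib

/-! Words in `L` are lists, the partial product is a partial function `List L →. L`
(so `x ∈ prod w` says that `w` lies in the domain and that its product is `x`). -/

/-- A partial group structure on the type `L`. -/
@[ext]
structure PartialGroup (L : Type*) where
  /-- the partial product; its domain is `prod.Dom` -/
  prod : List L →. L
  /-- the inversion -/
  inv : L → L
  nonempty : Nonempty L
  inv_inv : ∀ g, inv (inv g) = g
  dom_append : ∀ u v, (prod (u ++ v)).Dom → (prod u).Dom ∧ (prod v).Dom
  /-- all words of length one are in the domain, and the product is the identity on them -/
  prod_single : ∀ g, g ∈ prod [g]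
  prod_assoc : ∀ u v w x y, x ∈ prod v → y ∈ prod (u ++ v ++ w) → y ∈ prod (u ++ [x] ++ w)
  prod_inv : ∀ w, (prod w).Dom → ∃ e ∈ prod [], e ∈ prod ((w.map inv).reverse ++ w)

namespace PartialGroup

variable {L : Type*} (𝓛 : PartialGroup L)

theorem nil_dom : (𝓛.prod []).Dom := by
  obtain ⟨g⟩ := 𝓛.nonempty
  exact (𝓛.dom_append [] [g] (Part.dom_iff_mem.2 ⟨g, 𝓛.prod_single g⟩)).1

/-- The identity element, the product of the empty word. -/
def one : L := (𝓛.prod []).get 𝓛.nil_dom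

/-- `x ^ g = prod (g⁻¹, x, g)`, which may be undefined. -/
def conj (g x : L) : Part L := 𝓛.prod [𝓛.inv g, x, g]

/-- `D(g)`, the set of all `x` for which `x ^ g` is defined. -/
def conjDom (g : L) : Set L := {x | (𝓛.conj g x).Dom}

/-- `H ^ g`, the set of all `h ^ g` with `h ∈ H` (used only for `H ⊆ D(g)`). -/
def conjSet (g : L) (H : Set L) : Set L := {y | ∃ h ∈ H, y ∈ 𝓛.conj g h}

/-- `H ⊆ D(g)` and `H ^ g = K`. -/
def ConjEq (g : L) (H K : Set L) : Prop := H ⊆ 𝓛.conjDom g ∧ 𝓛.conjSet g H = K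

/-- `N_L(H)` -/
def normalizer (H : Set L) : Set L := {g | 𝓛.ConjEq g H H}

/-- `C_L(H)` -/
def centralizer (H : Set L) : Set L := {g | ∀ h ∈ H, h ∈ 𝓛.conj g h}

structure IsPartialSubgroup (H : Set L) : Prop where
  nonempty : H.Nonempty
  inv_mem : ∀ g ∈ H, 𝓛.inv g ∈ H
  prod_mem : ∀ w : List L, (∀ x ∈ w, x ∈ H) → ∀ y ∈ 𝓛.prod w, y ∈ H

/-- A subgroup of a partial group: a partial subgroup on which all products are defined. -/
structure IsSubgroup (H : Set L) : Prop extends 𝓛.IsPartialSubgroup H where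
  word_dom : ∀ w : List L, (∀ x ∈ w, x ∈ H) → (𝓛.prod w).Dom

structure IsPartialNormal (N : Set L) : Prop extends 𝓛.IsPartialSubgroup N where
  conj_mem : ∀ g, ∀ n ∈ N, ∀ y ∈ 𝓛.conj g n, y ∈ N

/-- A `p`-subgroup: a subgroup whose order is a power of `p`. -/
def IsPSubgroup (p : ℕ) (H : Set L) : Prop := 𝓛.IsSubgroup H ∧ ∃ n, Nat.card H = p ^ n

/-- The coset `N f`. -/
def coset (N : Set L) (f : L) : Set L := {x | ∃ n ∈ N, x ∈ 𝓛.prod [n, f]}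

/-- Cosets of `N` that are maximal under inclusion among all cosets of `N`. -/
def IsMaximalCoset (N : Set L) (C : Set L) : Prop :=
  Maximal (fun C : Set L => ∃ f, C = 𝓛.coset N f) C

/-- The underlying set of `L / N`: the set of maximal cosets of `N`. -/
def Quotient (N : Set L) : Type _ := {C : Set L // 𝓛.IsMaximalCoset N C}

/-- `ρ : L → L / N` is the natural map: `ρ g` is the unique maximal coset containing `g`. -/
def IsNaturalMap (N : Set L) (ρ : L → 𝓛.Quotient N) : Prop :=
  ∀ g (C : 𝓛.Quotient N), g ∈ C.1 ↔ C = ρ g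

/-- Homomorphisms of partial groups. -/
def IsHom {L' : Type*} (𝓛' : PartialGroup L') (β : L → L') : Prop :=
  ∀ w, ∀ x ∈ 𝓛.prod w, β x ∈ 𝓛'.prod (w.map β)

/-- Projections of partial groups: homomorphisms that map the domain of the product onto the
domain of the product. -/
def IsProjection {L' : Type*} (𝓛' : PartialGroup L') (β : L → L') : Prop :=
  𝓛.IsHom 𝓛' β ∧ ∀ w', (𝓛'.prod w').Dom → ∃ w, (𝓛.prod w).Dom ∧ w.map β = w'

/-- `w ∈ D` via a sequence of members of `Δ` that starts with the given set: for
`w = (f₁, …, fₙ)` there are `P₀, …, Pₙ ∈ Δ` such that `P₀` is the given set and, for all `i`,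
`Pᵢ₋₁ ⊆ D(fᵢ)` and `Pᵢ₋₁ ^ fᵢ = Pᵢ`. -/
def Via (Δ : Set (Set L)) : Set L → List L → Prop
  | P, [] => P ∈ Δ
  | P, f :: w => P ∈ Δ ∧ ∃ Q, 𝓛.ConjEq f P Q ∧ Via Δ Q w

section lemmas

variable {𝓛}

theorem one_mem : 𝓛.one ∈ 𝓛.prod [] := Part.get_mem _

theorem prod_one {e : L} (h : e ∈ 𝓛.prod []) : e = 𝓛.one := Part.mem_unique h one_mem

theorem prod_inv_mem {w : List L} (h : (𝓛.prod w).Dom) :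
    𝓛.one ∈ 𝓛.prod ((w.map 𝓛.inv).reverse ++ w) := by
  obtain ⟨e, he, h⟩ := 𝓛.prod_inv w h
  rwa [prod_one he] at h

theorem dom_of_mem {w : List L} {x : L} (h : x ∈ 𝓛.prod w) : (𝓛.prod w).Dom :=
  Part.dom_iff_mem.2 ⟨x, h⟩

theorem dom_infix (u : List L) {v : List L} (w : List L) (h : (𝓛.prod (u ++ v ++ w)).Dom) :
    (𝓛.prod v).Dom := (𝓛.dom_append u v (𝓛.dom_append (u ++ v) w h).1).2

theorem inv_word (w : List L) :
    (((w.map 𝓛.inv).reverse).map 𝓛.inv).reverse = w := by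
  simp [Function.comp_def, 𝓛.inv_inv]

theorem dom_inv {w : List L} (h : (𝓛.prod w).Dom) : (𝓛.prod (w.map 𝓛.inv).reverse).Dom :=
  (𝓛.dom_append _ _ (dom_of_mem (prod_inv_mem h))).1

theorem prod_mul_inv_mem {w : List L} (h : (𝓛.prod w).Dom) :
    𝓛.one ∈ 𝓛.prod (w ++ (w.map 𝓛.inv).reverse) := by
  have := prod_inv_mem (dom_inv h)
  rwa [inv_word] at this

theorem inv_mul_mem (g : L) : 𝓛.one ∈ 𝓛.prod [𝓛.inv g, g] := by
  simpa using prod_inv_mem (dom_of_mem (𝓛.prod_single g))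

theorem mul_inv_mem (g : L) : 𝓛.one ∈ 𝓛.prod [g, 𝓛.inv g] := by
  simpa using prod_mul_inv_mem (dom_of_mem (𝓛.prod_single g))

theorem one_mul_mem (g : L) : g ∈ 𝓛.prod [𝓛.one, g] := by
  simpa using 𝓛.prod_assoc [] [] [g] _ g one_mem (𝓛.prod_single g)

theorem mul_one_mem (g : L) : g ∈ 𝓛.prod [g, 𝓛.one] := by
  simpa using 𝓛.prod_assoc [g] [] [] _ g one_mem (𝓛.prod_single g)

/-- Inverses are unique. -/
theorem eq_inv_of_mul {m k : L} (h : 𝓛.one ∈ 𝓛.prod [m, k]) : m = 𝓛.inv k := by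
  have h1 : (𝓛.prod ([m, k] ++ [𝓛.inv k] ++ [𝓛.inv m])).Dom := by
    simpa using dom_of_mem (prod_mul_inv_mem (dom_of_mem h))
  obtain ⟨z, hz⟩ := Part.dom_iff_mem.1 (𝓛.dom_append _ _ h1).1
  have a1 : z ∈ 𝓛.prod [𝓛.one, 𝓛.inv k] := by
    simpa using 𝓛.prod_assoc [] [m, k] [𝓛.inv k] _ z h (by simpa using hz)
  have a2 : z ∈ 𝓛.prod [m, 𝓛.one] := by
    simpa using 𝓛.prod_assoc [m] [k, 𝓛.inv k] [] _ z (mul_inv_mem k) (by simpa using hz)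
  rw [← Part.mem_unique a2 (mul_one_mem m), ← Part.mem_unique a1 (one_mul_mem _)]

theorem inv_prod_mem {w : List L} {k : L} (h : k ∈ 𝓛.prod w) :
    𝓛.inv k ∈ 𝓛.prod (w.map 𝓛.inv).reverse := by
  have hd := dom_of_mem h
  obtain ⟨m, hm⟩ := Part.dom_iff_mem.1 (dom_inv hd)
  have h1 := 𝓛.prod_assoc _ w [] _ _ h (by simpa using prod_inv_mem hd)
  have h2 := 𝓛.prod_assoc [] _ [k] _ _ hm (by simpa using h1)
  rwa [← eq_inv_of_mul (by simpa using h2)]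

theorem conj_inv {g x y : L} (h : y ∈ 𝓛.conj g x) : x ∈ 𝓛.conj (𝓛.inv g) y := by
  have h0 := dom_of_mem (prod_inv_mem (dom_of_mem (prod_inv_mem (dom_of_mem h))))
  have h1 : (𝓛.prod ([𝓛.inv g, 𝓛.inv x] ++ [g, 𝓛.inv g, x, g, 𝓛.inv g] ++
      [𝓛.inv x, g, 𝓛.inv g, x, g])).Dom := by
    simpa [𝓛.inv_inv] using h0
  obtain ⟨z, hz⟩ := Part.dom_iff_mem.1 (dom_infix _ _ h1)
  have a1 : z ∈ 𝓛.prod [g, y, 𝓛.inv g] := by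
    simpa using 𝓛.prod_assoc [g] [𝓛.inv g, x, g] [𝓛.inv g] y z h (by simpa using hz)
  have a2 : z ∈ 𝓛.prod [𝓛.one, x, g, 𝓛.inv g] := by
    simpa using 𝓛.prod_assoc [] [g, 𝓛.inv g] [x, g, 𝓛.inv g] _ z (mul_inv_mem g)
      (by simpa using hz)
  have a3 : z ∈ 𝓛.prod [𝓛.one, x, 𝓛.one] := by
    simpa using 𝓛.prod_assoc [𝓛.one, x] [g, 𝓛.inv g] [] _ z (mul_inv_mem g)
      (by simpa using a2)
  have a4 : z ∈ 𝓛.prod [x, 𝓛.one] := by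
    simpa using 𝓛.prod_assoc [] [𝓛.one, x] [𝓛.one] _ z (one_mul_mem x) (by simpa using a3)
  rw [Part.mem_unique (mul_one_mem x) a4]
  simpa [conj, 𝓛.inv_inv] using a1

theorem ConjEq.symm {g : L} {P Q : Set L} (h : 𝓛.ConjEq g P Q) :
    𝓛.ConjEq (𝓛.inv g) Q P := by
  obtain ⟨h1, rfl⟩ := h
  refine ⟨?_, ?_⟩
  · rintro y ⟨x, -, hy⟩
    exact dom_of_mem (conj_inv hy)
  · ext z
    constructor
    · rintro ⟨y, ⟨x, hx, hy⟩, hz⟩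
      rwa [Part.mem_unique hz (conj_inv hy)]
    · intro hz
      obtain ⟨y, hy⟩ := Part.dom_iff_mem.1 (h1 hz)
      exact ⟨y, ⟨z, hz, hy⟩, conj_inv hy⟩

theorem IsSubgroup.subset_normalizer {P : Set L} (hP : 𝓛.IsSubgroup P) :
    P ⊆ 𝓛.normalizer P := by
  have key : ∀ g ∈ P, ∀ x ∈ P, ∃ y ∈ P, y ∈ 𝓛.conj g x := by
    intro g hg x hx
    have hw : ∀ z ∈ [𝓛.inv g, x, g], z ∈ P := by
      simp [hg, hx, hP.inv_mem g hg]
    obtain ⟨y, hy⟩ := Part.dom_iff_mem.1 (hP.word_dom _ hw)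
    exact ⟨y, hP.prod_mem _ hw y hy, hy⟩
  intro g hg
  refine ⟨fun x hx => ?_, ?_⟩
  · obtain ⟨y, -, hy⟩ := key g hg x hx
    exact dom_of_mem hy
  · ext y
    constructor
    · rintro ⟨x, hx, hy⟩
      obtain ⟨y', hy', h⟩ := key g hg x hx
      rwa [Part.mem_unique hy h]
    · intro hy
      obtain ⟨x, hx, h⟩ := key _ (hP.inv_mem g hg) y hy
      exact ⟨x, hx, by simpa [𝓛.inv_inv] using conj_inv h⟩

end lemmas

/-- A subgroup of a partial group is a group with multiplication `x y = prod (x, y)`. -/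
noncomputable abbrev IsSubgroup.group {𝓛 : PartialGroup L} {H : Set L} (hH : 𝓛.IsSubgroup H) :
    Group H where
  mul x y := ⟨(𝓛.prod [x.1, y.1]).get (hH.word_dom _ (by simp)),
    hH.prod_mem [x.1, y.1] (by simp) _ (Part.get_mem _)⟩
  one := ⟨𝓛.one, hH.prod_mem [] (by simp) _ one_mem⟩
  inv x := ⟨𝓛.inv x.1, hH.inv_mem _ x.2⟩
  mul_assoc x y z := by
    obtain ⟨t, ht⟩ := Part.dom_iff_mem.1 (hH.word_dom [x.1, y.1, z.1] (by simp))
    apply Subtype.ext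
    have h1 : t ∈ 𝓛.prod [(𝓛.prod [x.1, y.1]).get (hH.word_dom _ (by simp)), z.1] := by
      simpa using 𝓛.prod_assoc [] [x.1, y.1] [z.1] _ t (Part.get_mem _) (by simpa using ht)
    have h2 : t ∈ 𝓛.prod [x.1, (𝓛.prod [y.1, z.1]).get (hH.word_dom _ (by simp))] := by
      simpa using 𝓛.prod_assoc [x.1] [y.1, z.1] [] _ t (Part.get_mem _) (by simpa using ht)
    exact (Part.mem_unique (Part.get_mem _) h1).trans (Part.mem_unique h2 (Part.get_mem _))
  one_mul x := Subtype.ext (Part.mem_unique (Part.get_mem _) (one_mul_mem x.1))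
  mul_one x := Subtype.ext (Part.mem_unique (Part.get_mem _) (mul_one_mem x.1))
  inv_mul_cancel x := Subtype.ext (Part.mem_unique (Part.get_mem _) (inv_mul_mem x.1))

end PartialGroup

/-- A locality `(L, Δ, S)` at the prime `p` on the finite set `L`. -/
structure Locality (p : ℕ) (L : Type*) extends PartialGroup L where
  finite : Finite L
  S : Set L
  Δ : Set (Set L)
  S_pSubgroup : toPartialGroup.IsPSubgroup p S
  Δ_nonempty : Δ.Nonempty
  Δ_subgroup : ∀ P ∈ Δ, toPartialGroup.IsSubgroup P ∧ P ⊆ S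
  /-- `S` is maximal among the `p`-subgroups -/
  S_maximal : ∀ T, toPartialGroup.IsPSubgroup p T → S ⊆ T → T = S
  /-- a word lies in the domain if and only if it does so via some members of `Δ` -/
  dom_iff : ∀ w, (prod w).Dom ↔ ∃ P, toPartialGroup.Via Δ P w
  /-- `Δ` is closed under overgroups in `S` -/
  Δ_overgroup : ∀ P ∈ Δ, ∀ Q, toPartialGroup.IsSubgroup Q → P ⊆ Q → Q ⊆ S → Q ∈ Δ
  /-- `Δ` is closed under conjugation within `S` -/
  Δ_conj : ∀ P ∈ Δ, ∀ g, ∀ Q, toPartialGroup.ConjEq g P Q → Q ⊆ S → Q ∈ Δ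

/-- A fusion system over the group `S`: a category whose objects are the subgroups of `S` and
whose morphisms are injective homomorphisms, containing all the homomorphisms induced by
conjugation in `S`, and such that every morphism is an isomorphism of the category followed by
an inclusion. -/
structure FusionSystem (S : Type*) [Group S] where
  Hom : ∀ P Q : Subgroup S, Set (P →* Q)
  injective : ∀ P Q, ∀ φ ∈ Hom P Q, Function.Injective φ
  inner : ∀ (P Q : Subgroup S) (φ : P →* Q) (s : S),
    (∀ x, (φ x : S) = s⁻¹ * x * s) → φ ∈ Hom P Q
  comp : ∀ (P Q R : Subgroup S), ∀ φ ∈ Hom P Q, ∀ ψ ∈ Hom Q R, ψ.comp φ ∈ Hom P R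
  /-- if `ψ` is the isomorphism from `P` to its image `R` that is obtained from `φ` by
  restricting the codomain, then `ψ` and `ψ⁻¹` are morphisms -/
  iso : ∀ (P Q R : Subgroup S), ∀ φ ∈ Hom P Q, ∀ ψ : P ≃* R,
    (∀ x, (ψ x : S) = φ x) → ψ.toMonoidHom ∈ Hom P R ∧ ψ.symm.toMonoidHom ∈ Hom R P

namespace FusionSystem

/-- The fusion system over `S` generated by a family of injective homomorphisms between
subgroups of `S`: the smallest fusion system containing it. (Members of the family that are not
injective, which cannot lie in a fusion system, have no bearing on the injectivity of the
morphisms.) -/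
def generate {S : Type*} [Group S] (X : ∀ P Q : Subgroup S, Set (P →* Q)) : FusionSystem S where
  Hom P Q := {φ | Function.Injective φ ∧
    ∀ F : FusionSystem S, (∀ P' Q', X P' Q' ⊆ F.Hom P' Q') → φ ∈ F.Hom P Q}
  injective _ _ _ h := h.1
  inner P Q φ s h := ⟨fun x y hxy => by
      have hx := h x
      rw [hxy, h y] at hx
      exact Subtype.ext (mul_left_cancel (mul_right_cancel hx)).symm,
    fun F _ => F.inner P Q φ s h⟩
  comp P Q R φ hφ ψ hψ := ⟨hψ.1.comp hφ.1,
    fun F hF => F.comp P Q R φ (hφ.2 F hF) ψ (hψ.2 F hF)⟩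
  iso P Q R φ hφ ψ h :=
    ⟨⟨ψ.injective, fun F hF => (F.iso P Q R φ (hφ.2 F hF) ψ h).1⟩,
      ⟨ψ.symm.injective, fun F hF => (F.iso P Q R φ (hφ.2 F hF) ψ h).2⟩⟩

/-- The isomorphism of groups `e : S ≃* T` carries the fusion system `F` to the fusion system
`F'`, that is, `F = F'` if `S` and `T` are identified via `e`. -/
def CarriedBy {S T : Type*} [Group S] [Group T] (e : S ≃* T) (F : FusionSystem S)
    (F' : FusionSystem T) : Prop :=
  ∀ (P Q : Subgroup S) (φ : P →* Q), φ ∈ F.Hom P Q ↔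
    (e.subgroupMap Q).toMonoidHom.comp (φ.comp (e.subgroupMap P).symm.toMonoidHom) ∈
      F'.Hom (P.map e.toMonoidHom) (Q.map e.toMonoidHom)

end FusionSystem

namespace Locality

open PartialGroup

variable {p : ℕ} {L : Type*} (𝓛 : Locality p L)

theorem word_dom_of_normalizer {P : Set L} (hP : P ∈ 𝓛.Δ) (w : List L)
    (hw : ∀ x ∈ w, x ∈ 𝓛.normalizer P) : (𝓛.prod w).Dom := by
  refine (𝓛.dom_iff w).2 ⟨P, ?_⟩
  induction w with
  | nil => exact hP
  | cons f w ih =>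
    exact ⟨hP, P, hw f (by simp), ih fun x hx => hw x (by simp [hx])⟩

/-- The normalizer of an object is a subgroup. -/
theorem normalizer_isSubgroup {P : Set L} (hP : P ∈ 𝓛.Δ) :
    𝓛.IsSubgroup (𝓛.normalizer P) := by
  have hPN := (𝓛.Δ_subgroup P hP).1.subset_normalizer
  have hone : 𝓛.one ∈ 𝓛.normalizer P :=
    hPN ((𝓛.Δ_subgroup P hP).1.prod_mem [] (by simp) _ one_mem)
  have hinv : ∀ g ∈ 𝓛.normalizer P, 𝓛.inv g ∈ 𝓛.normalizer P := fun g hg => ConjEq.symm hg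
  have hmul : ∀ f ∈ 𝓛.normalizer P, ∀ h ∈ 𝓛.normalizer P, ∀ k ∈ 𝓛.prod [f, h],
      k ∈ 𝓛.normalizer P := by
    intro f hf h hh k hk
    have key : ∀ x ∈ P, ∀ y z, y ∈ 𝓛.conj f x → z ∈ 𝓛.conj h y → z ∈ 𝓛.conj k x := by
      intro x hx y z hy hz
      obtain ⟨t, ht⟩ := Part.dom_iff_mem.1 (𝓛.word_dom_of_normalizer hP
        [𝓛.inv h, 𝓛.inv f, x, f, h] (by simp [hinv f hf, hinv h hh, hf, hh, hPN hx]))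
      have h1 : t ∈ 𝓛.prod [𝓛.inv h, y, h] := by
        simpa using 𝓛.prod_assoc [𝓛.inv h] [𝓛.inv f, x, f] [h] y t hy (by simpa using ht)
      have hk' : 𝓛.inv k ∈ 𝓛.prod [𝓛.inv h, 𝓛.inv f] := by simpa using inv_prod_mem hk
      have h2 : t ∈ 𝓛.prod [𝓛.inv k, x, f, h] := by
        simpa using 𝓛.prod_assoc [] [𝓛.inv h, 𝓛.inv f] [x, f, h] _ t hk' (by simpa using ht)
      have h3 : t ∈ 𝓛.prod [𝓛.inv k, x, k] := by
        simpa using 𝓛.prod_assoc [𝓛.inv k, x] [f, h] [] _ t hk (by simpa using h2)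
      rw [Part.mem_unique hz h1]
      exact h3
    have step : ∀ g ∈ 𝓛.normalizer P, ∀ x ∈ P, ∃ y ∈ P, y ∈ 𝓛.conj g x := by
      intro g hg x hx
      obtain ⟨y, hy⟩ := Part.dom_iff_mem.1 (hg.1 hx)
      exact ⟨y, hg.2.subset ⟨x, hx, hy⟩, hy⟩
    refine ⟨fun x hx => ?_, ?_⟩
    · obtain ⟨y, hyP, hy⟩ := step f hf x hx
      obtain ⟨z, hzP, hz⟩ := step h hh y hyP
      exact dom_of_mem (key x hx y z hy hz)
    · ext z
      constructor
      · rintro ⟨x, hx, hxz⟩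
        obtain ⟨y, hyP, hy⟩ := step f hf x hx
        obtain ⟨z', hzP, hz⟩ := step h hh y hyP
        rwa [Part.mem_unique hxz (key x hx y z' hy hz)]
      · intro hz
        obtain ⟨y, hyP, hy⟩ := hh.2.superset hz
        obtain ⟨x, hxP, hx⟩ := hf.2.superset hyP
        exact ⟨x, hxP, key x hxP y z hx hy⟩
  refine ⟨⟨⟨_, hone⟩, hinv, ?_⟩, 𝓛.word_dom_of_normalizer hP⟩
  intro w
  induction w with
  | nil => intro _ y hy; rwa [prod_one hy]
  | cons f w ih =>
    intro hw y hy
    have hw' : ∀ x ∈ w, x ∈ 𝓛.normalizer P := fun x hx => hw x (by simp [hx])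
    obtain ⟨k, hk⟩ := Part.dom_iff_mem.1 (𝓛.word_dom_of_normalizer hP w hw')
    have h1 := 𝓛.prod_assoc [f] w [] k y hk (by simpa using hy)
    exact hmul f (hw f (by simp)) k (ih hw' k hk) y (by simpa using h1)

noncomputable instance groupS : Group 𝓛.S := 𝓛.S_pSubgroup.1.group

noncomputable instance groupNormalizer (P : 𝓛.Δ) : Group (𝓛.normalizer P.1) :=
  (𝓛.normalizer_isSubgroup P.2).group

/-- The fusion system `F_S(L)` over `S`, generated by the conjugation maps `x ↦ x ^ g`, `g ∈ L`,
between subgroups of `S`. -/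
noncomputable def fusionSystem : FusionSystem 𝓛.S :=
  FusionSystem.generate fun P _ => {φ | ∃ g : L, ∀ x : P, ((φ x).1.1 : L) ∈ 𝓛.conj g x.1.1}

/-- A signalizer functor of `(L, Δ, S)` on objects. -/
structure SignalizerFunctor where
  Θ : ∀ P : 𝓛.Δ, Subgroup (𝓛.normalizer P.1)
  normal : ∀ P, (Θ P).Normal
  coprime : ∀ P, (Nat.card (Θ P)).Coprime p
  /-- `Θ(P) ^ g = Θ(P ^ g)` whenever `P ^ g` is defined and contained in `S` (and hence is
  an object) -/
  conj : ∀ (P Q : 𝓛.Δ) (g : L), 𝓛.ConjEq g P.1 Q.1 →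
    𝓛.ConjEq g (Subtype.val '' (Θ P : Set (𝓛.normalizer P.1)))
      (Subtype.val '' (Θ Q : Set (𝓛.normalizer Q.1)))
  /-- `Θ(P) ∩ C_L(Q) = Θ(Q)` for `P ≤ Q` -/
  balance : ∀ P Q : 𝓛.Δ, P.1 ⊆ Q.1 →
    Subtype.val '' (Θ P : Set (𝓛.normalizer P.1)) ∩ 𝓛.centralizer Q.1 =
      Subtype.val '' (Θ Q : Set (𝓛.normalizer Q.1))

instance (𝓣 : 𝓛.SignalizerFunctor) (P : 𝓛.Δ) : (𝓣.Θ P).Normal := 𝓣.normal P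

variable {𝓛} in
/-- The union of all the `Θ(P)`, as a subset of `L`. -/
def SignalizerFunctor.union (𝓣 : 𝓛.SignalizerFunctor) : Set L :=
  ⋃ P : 𝓛.Δ, Subtype.val '' (𝓣.Θ P : Set (𝓛.normalizer P.1))

/-- Partial normal `p'`-subgroups. -/
def IsPartialNormalPPrime (N : Set L) : Prop :=
  𝓛.IsPartialNormal N ∧ N ∩ 𝓛.S = {𝓛.one}

end Locality

/-!
# The quotient of a locality by a signalizer functor on objects

For `f` in the locality let `S_f` be the set of all `x ∈ S` such that `x ^ f` is defined and lies
in `S`; it is an object. The elements `f` with `P ^ f = Q` are the morphisms from `P` to `Q` in a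
groupoid whose objects are the members of `Δ`, and the groups `Θ(P)` form a conjugation-invariant
family of normal subgroups of its vertex groups. Say that `f` and `g` *agree* on `P` if they have
the same target and `f ∈ Θ(P) g`. Everything is deduced from three properties of this relation.

* *Agreement propagates upwards* (`Agree.extend`). If `f` and `g` agree on `P`, and an object
  `A ≥ P` that normalizes `P` is contained in `S_f` and `S_g`, then `a ^ f` and `a ^ g` differ by
  an element of `Θ(Q) ∩ S = 1` for `a ∈ A`. So `f g⁻¹ ∈ Θ(P)` centralizes `A` and thus lies in
  `Θ(A)`. As normalizers grow in `p`-groups, `f` and `g` agree on `S_f ∩ S_g`. With `g = 1` this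
  says that an element `n` of the union of the signalizers lies in `Θ(S_n)`, which makes the union
  a partial normal `p'`-subgroup.
* *Common extensions exist* (`Sim.exists_extension`). If `f` and `g` agree on some object, then
  there is `k` with `S_f, S_g ≤ S_k` that agrees with `f` on `S_f` and with `g` on `S_g`. The step
  from `P` to the normalizers of `P` in `S_f` and `S_g` is Sylow's theorem in `Θ(Q) N_S(Q)`
  (`exists_agree_source`). Hence every element has an essentially unique maximal extension, and
  the maximal cosets are the cosets of the maximal extensions.
* *Conjugation lifts* (`conj_rep`). If `x, y ∈ S` and `x` is conjugated to `y` modulo `Θ` by the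
  coset of a maximal extension `f`, then `y = x ^ f`. Indeed, `x⁻¹ f y` represents the same coset
  as `f`, so that `x` normalizes `S_f`. Then `x ^ f ∈ Θ(Q) y`, where `Q` is the conjugate of `S_f`
  by `f`, and Sylow's theorem and the maximality of `f` give `x ∈ S_f`.

A word of maximal cosets is multiplied by multiplying the maximal extensions that represent its
letters. Replacing the letters of a word by maximal extensions preserves the sequence of objects
via which it is defined, and the new product agrees with the old one; this gives the axioms of a
partial group and shows that the natural map is a projection. By the lifting property, the
conjugation of objects in the quotient is the same as conjugation in the locality by maximal
extensions, from which the axioms of a locality, the equality of the fusion systems and the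
description of the normalizers follow.
-/

/-! ### Partial groups -/

namespace PartialGroup

variable {L L' : Type*} {𝓛 : PartialGroup L} {𝓛' : PartialGroup L'}

/-- If `y = x ^ f`, then `f = x⁻¹ f y`. -/
theorem conj_swap {f x y : L} (h : y ∈ 𝓛.conj f x) : f ∈ 𝓛.prod [𝓛.inv x, f, y] := by
  have h0 : (𝓛.prod ([𝓛.inv f] ++ [𝓛.inv x, f, 𝓛.inv f, x, f])).Dom := by
    simpa [𝓛.inv_inv] using dom_of_mem (prod_inv_mem (dom_of_mem h))
  obtain ⟨z, hz⟩ := Part.dom_iff_mem.1 (𝓛.dom_append _ _ h0).2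
  have a1 : z ∈ 𝓛.prod [𝓛.inv x, f, y] := by
    simpa using 𝓛.prod_assoc [𝓛.inv x, f] [𝓛.inv f, x, f] [] y z h (by simpa using hz)
  have a2 : z ∈ 𝓛.prod [𝓛.inv x, 𝓛.one, x, f] := by
    simpa using 𝓛.prod_assoc [𝓛.inv x] [f, 𝓛.inv f] [x, f] _ z (mul_inv_mem f)
      (by simpa using hz)
  have a3 : z ∈ 𝓛.prod [𝓛.inv x, x, f] := by
    simpa using 𝓛.prod_assoc [] [𝓛.inv x, 𝓛.one] [x, f] _ z (mul_one_mem _) (by simpa using a2)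
  have a4 : z ∈ 𝓛.prod [𝓛.one, f] := by
    simpa using 𝓛.prod_assoc [] [𝓛.inv x, x] [f] _ z (inv_mul_mem x) (by simpa using a3)
  rwa [Part.mem_unique a4 (one_mul_mem f)] at a1

theorem inv_one : 𝓛.inv 𝓛.one = 𝓛.one := (eq_inv_of_mul (one_mul_mem 𝓛.one)).symm

theorem conj_inv_elem {f x y : L} (h : y ∈ 𝓛.conj f x) : 𝓛.inv y ∈ 𝓛.conj f (𝓛.inv x) := by
  simpa [conj, 𝓛.inv_inv] using inv_prod_mem h

theorem mem_conj_one (x : L) : x ∈ 𝓛.conj 𝓛.one x := by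
  have h : (𝓛.prod [x]).Dom := dom_of_mem (𝓛.prod_single x)
  have h1 : x ∈ 𝓛.prod [𝓛.one, x, 𝓛.one] := by
    have a := 𝓛.prod_assoc [] [] [x] _ x one_mem (𝓛.prod_single x)
    simpa using 𝓛.prod_assoc [𝓛.one, x] [] [] _ x one_mem (by simpa using a)
  simpa [conj, inv_one] using h1

theorem ConjEq.exists_mem {g : L} {P Q : Set L} (h : 𝓛.ConjEq g P Q) {x : L} (hx : x ∈ P) :
    ∃ y ∈ Q, y ∈ 𝓛.conj g x := by
  obtain ⟨y, hy⟩ := Part.dom_iff_mem.1 (h.1 hx)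
  exact ⟨y, h.2.subset ⟨x, hx, hy⟩, hy⟩

theorem ConjEq.mem_of_conj {g : L} {P Q : Set L} (h : 𝓛.ConjEq g P Q) {x y : L} (hx : x ∈ P)
    (hy : y ∈ 𝓛.conj g x) : y ∈ Q :=
  h.2.subset ⟨x, hx, hy⟩

theorem ConjEq.target_unique {g : L} {P Q R : Set L} (h : 𝓛.ConjEq g P Q)
    (h' : 𝓛.ConjEq g P R) : Q = R :=
  h.2.symm.trans h'.2

theorem conjEq_of_forall {g : L} {P Q : Set L} (h : ∀ x ∈ P, ∃ y ∈ Q, y ∈ 𝓛.conj g x)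
    (h' : ∀ y ∈ Q, ∃ x ∈ P, y ∈ 𝓛.conj g x) : 𝓛.ConjEq g P Q := by
  refine ⟨fun x hx => ?_, ?_⟩
  · obtain ⟨y, -, hy⟩ := h x hx
    exact dom_of_mem hy
  · ext y
    refine ⟨?_, h' y⟩
    rintro ⟨x, hx, hy⟩
    obtain ⟨y', hy', hy''⟩ := h x hx
    rwa [Part.mem_unique hy hy'']

theorem conjEq_one (P : Set L) : 𝓛.ConjEq 𝓛.one P P :=
  conjEq_of_forall (fun x hx => ⟨x, hx, mem_conj_one x⟩) fun x hx => ⟨x, hx, mem_conj_one x⟩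

theorem ConjEq.card_eq {g : L} {P Q : Set L} (h : 𝓛.ConjEq g P Q) : Nat.card P = Nat.card Q := by
  choose φ hφ hc using fun x : P => h.exists_mem x.2
  choose ψ hψ hd using fun x : Q => h.symm.exists_mem x.2
  refine Nat.card_congr ⟨fun x => ⟨φ x, hφ x⟩, fun y => ⟨ψ y, hψ y⟩, fun x => ?_, fun y => ?_⟩
  · exact Subtype.ext (Part.mem_unique (hd _) (conj_inv (hc x)))
  · refine Subtype.ext (Part.mem_unique (hc _) ?_)
    simpa [𝓛.inv_inv] using conj_inv (hd y)

/-- A conjugate of `P` that is contained in `P` is equal to `P`, by finiteness. -/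
theorem ConjEq.eq_of_subset [Finite L] {g : L} {P Q : Set L} (h : 𝓛.ConjEq g P Q)
    (hs : Q ⊆ P) : Q = P := by
  refine Set.eq_of_subset_of_ncard_le hs ?_ (Set.toFinite _)
  rw [← Nat.card_coe_set_eq, ← Nat.card_coe_set_eq, h.card_eq]

theorem mem_of_via {Δ : Set (Set L)} {P : Set L} {w : List L} (h : 𝓛.Via Δ P w) : P ∈ Δ := by
  cases w with
  | nil => exact h
  | cons f w => exact h.1

/-! ### Subgroups of partial groups -/

theorem IsSubgroup.one_mem {H : Set L} (hH : 𝓛.IsSubgroup H) : 𝓛.one ∈ H :=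
  hH.prod_mem [] (by simp) _ PartialGroup.one_mem

theorem IsSubgroup.mul_mem {H : Set L} (hH : 𝓛.IsSubgroup H) {x y z : L} (hx : x ∈ H)
    (hy : y ∈ H) (hz : z ∈ 𝓛.prod [x, y]) : z ∈ H :=
  hH.prod_mem [x, y] (by simp [hx, hy]) z hz

theorem IsSubgroup.inter {H K : Set L} (hH : 𝓛.IsSubgroup H) (hK : 𝓛.IsSubgroup K) :
    𝓛.IsSubgroup (H ∩ K) where
  nonempty := ⟨_, hH.one_mem, hK.one_mem⟩
  inv_mem g hg := ⟨hH.inv_mem g hg.1, hK.inv_mem g hg.2⟩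
  prod_mem w hw y hy :=
    ⟨hH.prod_mem w (fun x hx => (hw x hx).1) y hy, hK.prod_mem w (fun x hx => (hw x hx).2) y hy⟩
  word_dom w hw := hH.word_dom w fun x hx => (hw x hx).1

/-- A subset of a subgroup that is closed under inverses and binary products is a subgroup. -/
theorem IsSubgroup.of_subset {H K : Set L} (hH : 𝓛.IsSubgroup H) (hK : K ⊆ H)
    (hone : 𝓛.one ∈ K) (hinv : ∀ g ∈ K, 𝓛.inv g ∈ K)
    (hmul : ∀ x ∈ K, ∀ y ∈ K, ∀ z ∈ 𝓛.prod [x, y], z ∈ K) : 𝓛.IsSubgroup K where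
  nonempty := ⟨_, hone⟩
  inv_mem := hinv
  word_dom w hw := hH.word_dom w fun x hx => hK (hw x hx)
  prod_mem w := by
    induction w with
    | nil => intro _ y hy; rwa [prod_one hy]
    | cons f w ih =>
      intro hw y hy
      have hw' : ∀ x ∈ w, x ∈ K := fun x hx => hw x (by simp [hx])
      obtain ⟨k, hk⟩ := Part.dom_iff_mem.1 (hH.word_dom w fun x hx => hK (hw' x hx))
      exact hmul f (hw f (by simp)) k (ih hw' k hk) y
        (by simpa using 𝓛.prod_assoc [f] w [] k y hk (by simpa using hy))

theorem IsSubgroup.coe_mul_mem {H : Set L} (hH : 𝓛.IsSubgroup H) (x y : H) :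
    letI := hH.group
    ((x * y : H) : L) ∈ 𝓛.prod [x.1, y.1] :=
  Part.get_mem _

theorem IsSubgroup.coe_mul₃_mem {H : Set L} (hH : 𝓛.IsSubgroup H) (x y z : H) :
    letI := hH.group
    ((x * y * z : H) : L) ∈ 𝓛.prod [x.1, y.1, z.1] := by
  let := hH.group
  obtain ⟨t, ht⟩ := Part.dom_iff_mem.1 (hH.word_dom [x.1, y.1, z.1] (by simp))
  have h1 : t ∈ 𝓛.prod [(x * y : H).1, z.1] := by
    simpa using 𝓛.prod_assoc [] [x.1, y.1] [z.1] _ t (hH.coe_mul_mem x y) (by simpa using ht)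
  rwa [Part.mem_unique (hH.coe_mul_mem (x * y) z) h1]

theorem IsSubgroup.coe_conj_mem {H : Set L} (hH : 𝓛.IsSubgroup H) (x g : H) :
    letI := hH.group
    ((g⁻¹ * x * g : H) : L) ∈ 𝓛.conj g.1 x.1 :=
  letI := hH.group
  hH.coe_mul₃_mem g⁻¹ x g

theorem IsSubgroup.coe_pow_mem {H : Set L} (hH : 𝓛.IsSubgroup H) (x : H) (n : ℕ) :
    letI := hH.group
    ((x ^ n : H) : L) ∈ 𝓛.prod (List.replicate n x.1) := by
  let := hH.group
  induction n with
  | zero => exact PartialGroup.one_mem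
  | succ n ih =>
    obtain ⟨t, ht⟩ := Part.dom_iff_mem.1 (hH.word_dom (List.replicate (n + 1) x.1)
      fun y hy => by rw [List.eq_of_mem_replicate hy]; exact x.2)
    have h1 : t ∈ 𝓛.prod [x.1, (x ^ n : H).1] := by
      simpa using 𝓛.prod_assoc [x.1] (List.replicate n x.1) [] _ t ih
        (by simpa [List.replicate_succ] using ht)
    rw [pow_succ', Part.mem_unique (hH.coe_mul_mem x (x ^ n)) h1]
    exact ht

/-- The subgroup `K` of a partial group, as a subgroup of the group `H` that contains it. -/
def IsSubgroup.subgroupIn {H K : Set L} (hH : 𝓛.IsSubgroup H) (hK : 𝓛.IsSubgroup K) :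
    letI := hH.group
    Subgroup H :=
  letI := hH.group
  { carrier := {x | x.1 ∈ K}
    mul_mem' := fun {x y} hx hy => hK.mul_mem hx hy (hH.coe_mul_mem x y)
    one_mem' := hK.one_mem
    inv_mem' := fun {x} hx => hK.inv_mem x.1 hx }

theorem IsSubgroup.mem_subgroupIn {H K : Set L} (hH : 𝓛.IsSubgroup H) (hK : 𝓛.IsSubgroup K)
    (x : H) : letI := hH.group
    x ∈ hH.subgroupIn hK ↔ x.1 ∈ K := Iff.rfl

theorem IsSubgroup.image_subgroup {H : Set L} (hH : 𝓛.IsSubgroup H)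
    (K : letI := hH.group; Subgroup H) : 𝓛.IsSubgroup (Subtype.val '' (K : Set H)) := by
  let := hH.group
  refine hH.of_subset (by rintro _ ⟨x, -, rfl⟩; exact x.2) ⟨1, K.one_mem, rfl⟩ ?_ ?_
  · rintro _ ⟨x, hx, rfl⟩
    exact ⟨x⁻¹, K.inv_mem hx, rfl⟩
  · rintro _ ⟨x, hx, rfl⟩ _ ⟨y, hy, rfl⟩ z hz
    exact ⟨x * y, K.mul_mem hx hy, Part.mem_unique (hH.coe_mul_mem x y) hz⟩

theorem IsPSubgroup.isPGroup {p : ℕ} [Fact p.Prime] {H : Set L} (hH : 𝓛.IsPSubgroup p H) :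
    letI := hH.1.group
    IsPGroup p H :=
  letI := hH.1.group
  IsPGroup.of_card hH.2.choose_spec

theorem IsPSubgroup.of_isPGroup {p : ℕ} [Fact p.Prime] [Finite L] {H : Set L}
    (hH : 𝓛.IsSubgroup H) (h : letI := hH.group; IsPGroup p H) : 𝓛.IsPSubgroup p H :=
  letI := hH.group
  ⟨hH, IsPGroup.iff_card.1 h⟩

theorem IsPSubgroup.mono {p : ℕ} [Fact p.Prime] [Finite L] {H K : Set L}
    (hH : 𝓛.IsPSubgroup p H) (hK : 𝓛.IsSubgroup K) (h : K ⊆ H) : 𝓛.IsPSubgroup p K := by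
  let := hH.1.group
  let := hK.group
  refine .of_isPGroup hK (hH.isPGroup.of_injective
    (MonoidHom.mk' (fun x : K => (⟨x.1, h x.2⟩ : H)) fun x y => ?_) fun x y hxy => ?_)
  · exact Subtype.ext (Part.mem_unique (hK.coe_mul_mem x y) (hH.1.coe_mul_mem ⟨x, _⟩ ⟨y, _⟩))
  · exact Subtype.ext (congrArg (fun z : H => z.1) hxy)

theorem IsPSubgroup.image_subgroup {p : ℕ} [Fact p.Prime] [Finite L] {H : Set L}
    (hH : 𝓛.IsSubgroup H) (K : letI := hH.group; Subgroup H)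
    (hK : letI := hH.group; IsPGroup p K) : 𝓛.IsPSubgroup p (Subtype.val '' (K : Set H)) := by
  let := hH.group
  refine ⟨hH.image_subgroup K, ?_⟩
  rw [Nat.card_image_of_injective Subtype.val_injective]
  exact IsPGroup.iff_card.1 hK

/-- A proper subgroup of a `p`-group is properly contained in its normalizer. -/
theorem IsPSubgroup.exists_mem_normalizer {p : ℕ} [Fact p.Prime] [Finite L] {R P : Set L}
    (hR : 𝓛.IsPSubgroup p R) (hP : 𝓛.IsSubgroup P) (h : P ⊂ R) :
    ∃ a ∈ R, a ∉ P ∧ a ∈ 𝓛.normalizer P := by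
  let := hR.1.group
  have : Group.IsNilpotent R := hR.isPGroup.isNilpotent
  have hlt : hR.1.subgroupIn hP < ⊤ := by
    refine lt_top_iff_ne_top.2 fun htop => h.2 fun x hx => ?_
    have : (⟨x, hx⟩ : R) ∈ hR.1.subgroupIn hP := by rw [htop]; trivial
    exact this
  obtain ⟨a, ha, haP⟩ := SetLike.exists_of_lt (Group.normalizerCondition_of_isNilpotent _ hlt)
  have hmem := Subgroup.mem_normalizer_iff'.1 ha
  refine ⟨a.1, a.2, haP, conjEq_of_forall (fun x hx => ?_) fun y hy => ?_⟩
  · refine ⟨_, ?_, hR.1.coe_conj_mem ⟨x, h.1 hx⟩ a⟩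
    have := (hmem (a⁻¹ * ⟨x, h.1 hx⟩)).2 (by rw [mul_inv_cancel_left]; exact hx)
    exact this
  · refine ⟨(a * ⟨y, h.1 hy⟩ * a⁻¹ : R).1, ?_, ?_⟩
    · have := (hmem (⟨y, h.1 hy⟩ * a⁻¹)).1 (by rw [inv_mul_cancel_right]; exact hy)
      rwa [← mul_assoc] at this
    · have := hR.1.coe_conj_mem (a * ⟨y, h.1 hy⟩ * a⁻¹) a
      simpa [mul_assoc] using this

/-! ### Homomorphisms of partial groups -/

theorem IsHom.map_one {β : L → L'} (hβ : 𝓛.IsHom 𝓛' β) : β 𝓛.one = 𝓛'.one :=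
  prod_one (by simpa using hβ [] _ one_mem)

theorem IsHom.map_inv {β : L → L'} (hβ : 𝓛.IsHom 𝓛' β) (g : L) :
    β (𝓛.inv g) = 𝓛'.inv (β g) := by
  have h := hβ _ _ (inv_mul_mem g)
  rw [hβ.map_one] at h
  exact eq_inv_of_mul (by simpa using h)

theorem IsHom.map_conj {β : L → L'} (hβ : 𝓛.IsHom 𝓛' β) {g x y : L} (h : y ∈ 𝓛.conj g x) :
    β y ∈ 𝓛'.conj (β g) (β x) := by
  simpa [conj, hβ.map_inv] using hβ _ _ h

theorem IsHom.map_conjEq {β : L → L'} (hβ : 𝓛.IsHom 𝓛' β) {g : L} {P Q : Set L}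
    (h : 𝓛.ConjEq g P Q) : 𝓛'.ConjEq (β g) (β '' P) (β '' Q) := by
  refine conjEq_of_forall ?_ ?_
  · rintro _ ⟨x, hx, rfl⟩
    obtain ⟨y, hy, hxy⟩ := h.exists_mem hx
    exact ⟨_, ⟨y, hy, rfl⟩, hβ.map_conj hxy⟩
  · rintro _ ⟨y, hy, rfl⟩
    obtain ⟨x, hx, hxy⟩ := h.2.superset hy
    exact ⟨_, ⟨x, hx, rfl⟩, hβ.map_conj hxy⟩

/-- The image of a subgroup under a homomorphism is a subgroup. -/
theorem IsHom.image_isSubgroup {β : L → L'} (hβ : 𝓛.IsHom 𝓛' β) {H : Set L}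
    (hH : 𝓛.IsSubgroup H) : 𝓛'.IsSubgroup (β '' H) := by
  have key : ∀ w : List L', (∀ x ∈ w, x ∈ β '' H) → ∃ y ∈ H, β y ∈ 𝓛'.prod w := by
    intro w hw
    have := 𝓛.nonempty
    choose! s hs hβs using hw
    have hd : ∀ x ∈ w.map s, x ∈ H := by
      intro x hx
      obtain ⟨y, hy, rfl⟩ := List.mem_map.1 hx
      exact hs y hy
    obtain ⟨y, hy⟩ := Part.dom_iff_mem.1 (hH.word_dom _ hd)
    refine ⟨y, hH.prod_mem _ hd y hy, ?_⟩
    have h := hβ _ _ hy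
    have e : (w.map s).map β = w := by
      rw [List.map_map]
      exact (List.map_congr_left hβs).trans (List.map_id w)
    rwa [e] at h
  refine ⟨⟨hH.nonempty.image β, ?_, fun w hw y hy => ?_⟩, fun w hw => ?_⟩
  · rintro _ ⟨g, hg, rfl⟩
    exact ⟨_, hH.inv_mem g hg, hβ.map_inv g⟩
  · obtain ⟨z, hz, h⟩ := key w hw
    exact ⟨z, hz, Part.mem_unique h hy⟩
  · obtain ⟨z, -, h⟩ := key w hw
    exact dom_of_mem h

/-- There is at most one partial group structure for which a given surjective map is a
projection. -/
theorem IsProjection.unique {β : L → L'} {𝓛'' : PartialGroup L'} (h : 𝓛.IsProjection 𝓛' β)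
    (h' : 𝓛.IsProjection 𝓛'' β) (hβ : Function.Surjective β) : 𝓛' = 𝓛'' := by
  have key : ∀ 𝓐 𝓑 : PartialGroup L', 𝓛.IsProjection 𝓐 β → 𝓛.IsProjection 𝓑 β →
      ∀ w y, y ∈ 𝓐.prod w → y ∈ 𝓑.prod w := by
    intro 𝓐 𝓑 hA hB w y hy
    obtain ⟨v, hv, rfl⟩ := hA.2 w (dom_of_mem hy)
    obtain ⟨x, hx⟩ := Part.dom_iff_mem.1 hv
    rw [Part.mem_unique hy (hA.1 _ _ hx)]
    exact hB.1 _ _ hx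
  ext1
  · funext w
    exact Part.ext fun y => ⟨key _ _ h h' w y, key _ _ h' h w y⟩
  · funext x
    obtain ⟨g, rfl⟩ := hβ x
    rw [← h.1.map_inv, ← h'.1.map_inv]

end PartialGroup

/-! ### The subgroups `S_f` -/

namespace Locality

open PartialGroup CategoryTheory

variable {p : ℕ} {L : Type*} {𝓛 : Locality p L}

theorem S_isSubgroup : 𝓛.IsSubgroup 𝓛.S := 𝓛.S_pSubgroup.1

theorem S_mem_Δ : 𝓛.S ∈ 𝓛.Δ := by
  obtain ⟨P, hP⟩ := 𝓛.Δ_nonempty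
  exact 𝓛.Δ_overgroup P hP _ S_isSubgroup (𝓛.Δ_subgroup P hP).2 subset_rfl

theorem exists_conjEq_of_mem_S {a : L} (ha : a ∈ 𝓛.S) {X : Set L} (hX : X ∈ 𝓛.Δ) :
    ∃ Y ∈ 𝓛.Δ, 𝓛.ConjEq a X Y := by
  have hXS := (𝓛.Δ_subgroup X hX).2
  have hN := S_isSubgroup.subset_normalizer ha
  have hc : 𝓛.ConjEq a X (𝓛.conjSet a X) := ⟨fun x hx => hN.1 (hXS hx), rfl⟩
  refine ⟨_, 𝓛.Δ_conj X hX a _ hc ?_, hc⟩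
  rintro y ⟨x, hx, hy⟩
  exact hN.mem_of_conj (hXS hx) hy

theorem via_dom {P : Set L} {w : List L} (h : 𝓛.Via 𝓛.Δ P w) : (𝓛.prod w).Dom :=
  (𝓛.dom_iff w).2 ⟨P, h⟩

theorem via_nil {P : Set L} (hP : P ∈ 𝓛.Δ) : 𝓛.Via 𝓛.Δ P [] := hP

theorem via_cons {P Q : Set L} {f : L} {w : List L} (hP : P ∈ 𝓛.Δ) (h : 𝓛.ConjEq f P Q)
    (hw : 𝓛.Via 𝓛.Δ Q w) : 𝓛.Via 𝓛.Δ P (f :: w) :=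
  ⟨hP, Q, h, hw⟩

theorem conjEq_mul {f g k : L} {P Q R : Set L} (hP : P ∈ 𝓛.Δ) (hQ : Q ∈ 𝓛.Δ) (hR : R ∈ 𝓛.Δ)
    (hf : 𝓛.ConjEq f P Q) (hg : 𝓛.ConjEq g Q R) (hk : k ∈ 𝓛.prod [f, g]) :
    𝓛.ConjEq k P R := by
  have key : ∀ x ∈ P, ∀ y z, y ∈ 𝓛.conj f x → z ∈ 𝓛.conj g y → z ∈ 𝓛.conj k x := by
    intro x hx y z hy hz
    have hv : 𝓛.Via 𝓛.Δ R [𝓛.inv g, 𝓛.inv f, x, f, g] :=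
      via_cons hR hg.symm <| via_cons hQ hf.symm <|
        via_cons hP ((𝓛.Δ_subgroup P hP).1.subset_normalizer hx) <|
        via_cons hP hf <| via_cons hQ hg <| via_nil hR
    obtain ⟨t, ht⟩ := Part.dom_iff_mem.1 (via_dom hv)
    have h1 : t ∈ 𝓛.prod [𝓛.inv g, y, g] := by
      simpa using 𝓛.prod_assoc [𝓛.inv g] [𝓛.inv f, x, f] [g] y t hy (by simpa using ht)
    have hk' : 𝓛.inv k ∈ 𝓛.prod [𝓛.inv g, 𝓛.inv f] := by simpa using inv_prod_mem hk
    have h2 : t ∈ 𝓛.prod [𝓛.inv k, x, f, g] := by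
      simpa using 𝓛.prod_assoc [] [𝓛.inv g, 𝓛.inv f] [x, f, g] _ t hk' (by simpa using ht)
    have h3 : t ∈ 𝓛.prod [𝓛.inv k, x, k] := by
      simpa using 𝓛.prod_assoc [𝓛.inv k, x] [f, g] [] _ t hk (by simpa using h2)
    rw [Part.mem_unique hz h1]
    exact h3
  refine conjEq_of_forall (fun x hx => ?_) fun z hz => ?_
  · obtain ⟨y, hy, hxy⟩ := hf.exists_mem hx
    obtain ⟨z, hz, hyz⟩ := hg.exists_mem hy
    exact ⟨z, hz, key x hx y z hxy hyz⟩
  · obtain ⟨y, hy, hyz⟩ := hg.2.superset hz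
    obtain ⟨x, hx, hxy⟩ := hf.2.superset hy
    exact ⟨x, hx, key x hx y z hxy hyz⟩

variable (𝓛) in
/-- The set `S_f` of all `x ∈ S` such that `x ^ f` is defined and lies in `S`. -/
def source (f : L) : Set L := {x | x ∈ 𝓛.S ∧ ∃ y ∈ 𝓛.S, y ∈ 𝓛.conj f x}

theorem source_subset (f : L) : 𝓛.source f ⊆ 𝓛.S := fun _ h => h.1

theorem subset_source {f : L} {P Q : Set L} (h : 𝓛.ConjEq f P Q) (hP : P ⊆ 𝓛.S)
    (hQ : Q ⊆ 𝓛.S) : P ⊆ 𝓛.source f := fun _ hx =>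
  ⟨hP hx, let ⟨y, hy, h⟩ := h.exists_mem hx
    ⟨y, hQ hy, h⟩⟩

/-- If `f` conjugates the object `X` into `S` and `b = a ^ f`, then
`f = a⁻¹ f b` conjugates `X ^ a` to `X ^ (f b)`. -/
theorem conjEq_of_conj {f a b : L} (hab : b ∈ 𝓛.conj f a)
    {X Y X' Y' : Set L} (hX : X ∈ 𝓛.Δ) (hY : Y ∈ 𝓛.Δ) (hX' : X' ∈ 𝓛.Δ) (hY' : Y' ∈ 𝓛.Δ)
    (hf : 𝓛.ConjEq f X Y) (haX : 𝓛.ConjEq a X X') (hbY : 𝓛.ConjEq b Y Y') :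
    𝓛.ConjEq f X' Y' := by
  have hv : 𝓛.Via 𝓛.Δ X' [𝓛.inv a, f, b] :=
    via_cons hX' haX.symm <| via_cons hX hf <| via_cons hY hbY <| via_nil hY'
  have h1 := conj_swap hab
  have hv' : 𝓛.Via 𝓛.Δ X [f, b] := via_cons hX hf <| via_cons hY hbY <| via_nil hY'
  obtain ⟨t, ht⟩ := Part.dom_iff_mem.1 (via_dom hv')
  have h2 : f ∈ 𝓛.prod [𝓛.inv a, t] := by
    simpa using 𝓛.prod_assoc [𝓛.inv a] [f, b] [] t f ht (by simpa using h1)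
  exact conjEq_mul hX' hX hY' haX.symm (conjEq_mul hX hY hY' hf hbY ht) h2

theorem source_isSubgroup (f : L) : 𝓛.IsSubgroup (𝓛.source f) := by
  obtain ⟨X, hX, Y, hf, hY⟩ := (𝓛.dom_iff [f]).1 (dom_of_mem (𝓛.prod_single f))
  replace hY : Y ∈ 𝓛.Δ := hY
  have hS : 𝓛.IsSubgroup 𝓛.S := S_isSubgroup
  refine hS.of_subset (source_subset f)
    (subset_source hf (𝓛.Δ_subgroup X hX).2 (𝓛.Δ_subgroup Y hY).2 (𝓛.Δ_subgroup X hX).1.one_mem)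
    ?_ ?_
  · rintro a ⟨ha, b, hb, hab⟩
    exact ⟨hS.inv_mem a ha, _, hS.inv_mem b hb, conj_inv_elem hab⟩
  · rintro a ⟨ha, b, hb, hab⟩ c ⟨hc, d, hd, hcd⟩ k hk
    obtain ⟨X', hX', haX⟩ := exists_conjEq_of_mem_S ha hX
    obtain ⟨Y', hY', hbY⟩ := exists_conjEq_of_mem_S hb hY
    obtain ⟨X'', hX'', hcX⟩ := exists_conjEq_of_mem_S hc hX'
    obtain ⟨Y'', hY'', hdY⟩ := exists_conjEq_of_mem_S hd hY'
    have h1 := conjEq_of_conj hab hX hY hX' hY' hf haX hbY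
    have h2 := conjEq_of_conj hcd hX' hY' hX'' hY'' h1 hcX hdY
    have hv : 𝓛.Via 𝓛.Δ Y [𝓛.inv f, a, f, 𝓛.inv f, c, f] :=
      via_cons hY hf.symm <| via_cons hX haX <| via_cons hX' h1 <|
        via_cons hY' h1.symm <| via_cons hX' hcX <| via_cons hX'' h2 <| via_nil hY''
    obtain ⟨t, ht⟩ := Part.dom_iff_mem.1 (via_dom hv)
    have t1 : t ∈ 𝓛.prod [b, 𝓛.inv f, c, f] := by
      simpa using 𝓛.prod_assoc [] [𝓛.inv f, a, f] [𝓛.inv f, c, f] b t hab (by simpa using ht)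
    have t2 : t ∈ 𝓛.prod [b, d] := by
      simpa using 𝓛.prod_assoc [b] [𝓛.inv f, c, f] [] d t hcd (by simpa using t1)
    have t3 : t ∈ 𝓛.prod [𝓛.inv f, a, 𝓛.one, c, f] := by
      simpa using 𝓛.prod_assoc [𝓛.inv f, a] [f, 𝓛.inv f] [c, f] _ t (mul_inv_mem f)
        (by simpa using ht)
    have t4 : t ∈ 𝓛.prod [𝓛.inv f, a, c, f] := by
      simpa using 𝓛.prod_assoc [𝓛.inv f] [a, 𝓛.one] [c, f] _ t (mul_one_mem a)
        (by simpa using t3)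
    have t5 : t ∈ 𝓛.prod [𝓛.inv f, k, f] := by
      simpa using 𝓛.prod_assoc [𝓛.inv f] [a, c] [f] _ t hk (by simpa using t4)
    exact ⟨hS.mul_mem ha hc hk, t, hS.mul_mem hb hd t2, t5⟩

theorem source_mem_Δ (f : L) : 𝓛.source f ∈ 𝓛.Δ := by
  obtain ⟨X, hX, Y, hf, hY⟩ := (𝓛.dom_iff [f]).1 (dom_of_mem (𝓛.prod_single f))
  replace hY : Y ∈ 𝓛.Δ := hY
  exact 𝓛.Δ_overgroup X hX _ (source_isSubgroup f)
    (subset_source hf (𝓛.Δ_subgroup X hX).2 (𝓛.Δ_subgroup Y hY).2) (source_subset f)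

theorem exists_conjEq_of_subset_source {f : L} {P : Set L} (hP : P ∈ 𝓛.Δ)
    (h : P ⊆ 𝓛.source f) : ∃ Q ∈ 𝓛.Δ, 𝓛.ConjEq f P Q := by
  have hc : 𝓛.ConjEq f P (𝓛.conjSet f P) :=
    ⟨fun _ hx => let ⟨_, _, _, hy⟩ := h hx; dom_of_mem hy, rfl⟩
  refine ⟨_, 𝓛.Δ_conj P hP f _ hc ?_, hc⟩
  rintro y ⟨x, hx, hy⟩
  obtain ⟨-, y', hy', h'⟩ := h hx
  rwa [Part.mem_unique hy h']

theorem source_eq_S {s : L} (hs : s ∈ 𝓛.S) : 𝓛.source s = 𝓛.S := by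
  have hN := S_isSubgroup.subset_normalizer hs
  exact subset_antisymm (source_subset s) (subset_source hN subset_rfl subset_rfl)

/-! ### The transporter groupoid -/

variable (𝓛) in
/-- The objects of the locality, as the objects of a groupoid in which the morphisms from `P` to
`Q` are the elements `f` of the locality with `P ^ f = Q`. -/
structure Obj where
  /-- the underlying member of `Δ` -/
  toΔ : 𝓛.Δ

/-- The underlying set of an object. -/
def Obj.set (P : 𝓛.Obj) : Set L := P.toΔ.1

theorem Obj.mem_Δ (P : 𝓛.Obj) : P.set ∈ 𝓛.Δ := P.toΔ.2

theorem Obj.isSubgroup (P : 𝓛.Obj) : 𝓛.IsSubgroup P.set := (𝓛.Δ_subgroup _ P.mem_Δ).1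

theorem Obj.subset_S (P : 𝓛.Obj) : P.set ⊆ 𝓛.S := (𝓛.Δ_subgroup _ P.mem_Δ).2

theorem Obj.ext' {P Q : 𝓛.Obj} (h : P.set = Q.set) : P = Q := by
  obtain ⟨P⟩ := P
  obtain ⟨Q⟩ := Q
  exact congrArg Obj.mk (Subtype.ext h)

theorem dom_of_conjEq {f g : L} {P Q R : 𝓛.Obj} (hf : 𝓛.ConjEq f P.set Q.set)
    (hg : 𝓛.ConjEq g Q.set R.set) : (𝓛.prod [f, g]).Dom :=
  (via_dom <| via_cons P.mem_Δ hf <| via_cons Q.mem_Δ hg <| via_nil R.mem_Δ)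

noncomputable instance : Groupoid 𝓛.Obj where
  Hom P Q := {f : L // 𝓛.ConjEq f P.set Q.set}
  id P := ⟨𝓛.one, conjEq_one _⟩
  comp {P Q R} f g := ⟨(𝓛.prod [f.1, g.1]).get (dom_of_conjEq f.2 g.2),
    conjEq_mul P.mem_Δ Q.mem_Δ R.mem_Δ f.2 g.2 (Part.get_mem _)⟩
  id_comp f := Subtype.ext (Part.mem_unique (Part.get_mem _) (one_mul_mem f.1))
  comp_id f := Subtype.ext (Part.mem_unique (Part.get_mem _) (mul_one_mem f.1))
  assoc {P Q R T} f g h := by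
    obtain ⟨t, ht⟩ := Part.dom_iff_mem.1 (via_dom <| via_cons P.mem_Δ f.2 <| via_cons Q.mem_Δ g.2 <|
      via_cons R.mem_Δ h.2 <| via_nil T.mem_Δ)
    apply Subtype.ext
    have h1 : t ∈ 𝓛.prod [(𝓛.prod [f.1, g.1]).get (dom_of_conjEq f.2 g.2), h.1] := by
      simpa using 𝓛.prod_assoc [] [f.1, g.1] [h.1] _ t (Part.get_mem _) (by simpa using ht)
    have h2 : t ∈ 𝓛.prod [f.1, (𝓛.prod [g.1, h.1]).get (dom_of_conjEq g.2 h.2)] := by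
      simpa using 𝓛.prod_assoc [f.1] [g.1, h.1] [] _ t (Part.get_mem _) (by simpa using ht)
    exact (Part.mem_unique (Part.get_mem _) h1).trans (Part.mem_unique h2 (Part.get_mem _))
  inv f := ⟨𝓛.inv f.1, f.2.symm⟩
  inv_comp f := Subtype.ext (Part.mem_unique (Part.get_mem _) (inv_mul_mem f.1))
  comp_inv f := Subtype.ext (Part.mem_unique (Part.get_mem _) (mul_inv_mem f.1))

/-- The element of the locality underlying a morphism. -/
def el {P Q : 𝓛.Obj} (f : P ⟶ Q) : L := f.1

/-- An element that conjugates `P` to `Q`, as a morphism. -/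
def homMk {P Q : 𝓛.Obj} (f : L) (h : 𝓛.ConjEq f P.set Q.set) : P ⟶ Q := ⟨f, h⟩

@[simp] theorem el_homMk {P Q : 𝓛.Obj} (f : L) (h : 𝓛.ConjEq f P.set Q.set) :
    el (homMk f h) = f := rfl

theorem el_conjEq {P Q : 𝓛.Obj} (f : P ⟶ Q) : 𝓛.ConjEq (el f) P.set Q.set := f.2

theorem el_injective {P Q : 𝓛.Obj} : Function.Injective (el : (P ⟶ Q) → L) :=
  Subtype.val_injective

theorem el_id (P : 𝓛.Obj) : el (𝟙 P) = 𝓛.one := rfl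

theorem el_comp_mem {P Q R : 𝓛.Obj} (f : P ⟶ Q) (g : Q ⟶ R) :
    el (f ≫ g) ∈ 𝓛.prod [el f, el g] := Part.get_mem _

theorem el_inv {P Q : 𝓛.Obj} (f : P ⟶ Q) : el (inv f) = 𝓛.inv (el f) := by
  rw [← Groupoid.inv_eq_inv]
  rfl

theorem el_comp₃_mem {P Q R T : 𝓛.Obj} (f : P ⟶ Q) (g : Q ⟶ R) (h : R ⟶ T) :
    el (f ≫ g ≫ h) ∈ 𝓛.prod [el f, el g, el h] := by
  obtain ⟨t, ht⟩ := Part.dom_iff_mem.1 (via_dom <| via_cons P.mem_Δ (el_conjEq f) <|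
    via_cons Q.mem_Δ (el_conjEq g) <| via_cons R.mem_Δ (el_conjEq h) <| via_nil T.mem_Δ)
  have h2 : t ∈ 𝓛.prod [el f, el (g ≫ h)] := by
    simpa using 𝓛.prod_assoc [el f] [el g, el h] [] _ t (el_comp_mem g h) (by simpa using ht)
  rwa [Part.mem_unique (el_comp_mem f (g ≫ h)) h2]

theorem el_conj_mem {P Q : 𝓛.Obj} (f : P ⟶ Q) (a : P ⟶ P) :
    el (inv f ≫ a ≫ f) ∈ 𝓛.conj (el f) (el a) := by
  have := el_comp₃_mem (inv f) a f
  rwa [el_inv] at this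

theorem el_comp_congr {P Q R P' Q' R' : 𝓛.Obj} {f : P ⟶ Q} {g : Q ⟶ R} {f' : P' ⟶ Q'}
    {g' : Q' ⟶ R'} (hf : el f = el f') (hg : el g = el g') : el (f ≫ g) = el (f' ≫ g') := by
  have h := el_comp_mem f g
  rw [hf, hg] at h
  exact Part.mem_unique h (el_comp_mem f' g')

theorem subset_source_el {P Q : 𝓛.Obj} (f : P ⟶ Q) : P.set ⊆ 𝓛.source (el f) :=
  subset_source f.2 P.subset_S Q.subset_S

/-- An element `f` with `P ≤ S_f` is a morphism with source `P`. -/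
theorem exists_hom {f : L} {P : 𝓛.Obj} (h : P.set ⊆ 𝓛.source f) :
    ∃ (Q : 𝓛.Obj) (a : P ⟶ Q), el a = f :=
  let ⟨Q, hQ, hf⟩ := exists_conjEq_of_subset_source P.mem_Δ h
  ⟨⟨⟨Q, hQ⟩⟩, homMk f hf, rfl⟩

theorem target_unique {P Q R : 𝓛.Obj} {f : P ⟶ Q} {g : P ⟶ R} (h : el f = el g) : Q = R :=
  Obj.ext' (f.2.target_unique (by have := g.2; rwa [show g.1 = f.1 from h.symm] at this))

end Locality

/-! ### Agreement of elements modulo a signalizer functor -/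

namespace Locality

open PartialGroup CategoryTheory

variable {p : ℕ} {L : Type*} {𝓛 : Locality p L}

/-- The vertex group of the transporter groupoid at `P` is the normalizer of `P`. -/
noncomputable def vertexEquiv (P : 𝓛.Obj) : (P ⟶ P) ≃* 𝓛.normalizer P.toΔ.1 where
  toFun n := ⟨n.1, n.2⟩
  invFun n := ⟨n.1, n.2⟩
  left_inv _ := rfl
  right_inv _ := rfl
  map_mul' _ _ := rfl

@[simp] theorem coe_vertexEquiv (P : 𝓛.Obj) (n : P ⟶ P) : (vertexEquiv P n).1 = el n := rfl

instance [Finite L] (P Q : 𝓛.Obj) : Finite (P ⟶ Q) := Finite.of_injective _ el_injective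

/-- The elements of `S` that normalize `P`, as a subgroup of the vertex group. -/
noncomputable def sylow (P : 𝓛.Obj) : Subgroup (P ⟶ P) where
  carrier := {c | el c ∈ 𝓛.S}
  mul_mem' {x y} hx hy := S_isSubgroup.mul_mem hx hy (el_comp_mem x y)
  one_mem' := S_isSubgroup.one_mem
  inv_mem' hx := S_isSubgroup.inv_mem _ hx

theorem mem_sylow {P : 𝓛.Obj} {c : P ⟶ P} : c ∈ sylow P ↔ el c ∈ 𝓛.S := Iff.rfl

theorem sylow_isPGroup [Fact p.Prime] (P : 𝓛.Obj) : IsPGroup p (sylow P) := by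
  refine 𝓛.S_pSubgroup.isPGroup.of_injective
    (MonoidHom.mk' (fun x : sylow P => (⟨el x.1, x.2⟩ : 𝓛.S)) fun x y => ?_) fun x y hxy => ?_
  · exact Subtype.ext (Part.mem_unique (el_comp_mem x.1 y.1)
      (S_isSubgroup.coe_mul_mem ⟨_, x.2⟩ ⟨_, y.2⟩))
  · exact Subtype.ext (el_injective (congrArg (fun z : 𝓛.S => z.1) hxy))

theorem el_pow_mem {P : 𝓛.Obj} (a : P ⟶ P) (n : ℕ) :
    el (a ^ n) ∈ 𝓛.prod (List.replicate n (el a)) := by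
  have h := (𝓛.normalizer_isSubgroup P.mem_Δ).coe_pow_mem (vertexEquiv P a) n
  have h2 := congrArg Subtype.val (map_pow (vertexEquiv P) a n)
  rw [coe_vertexEquiv] at h2
  rw [h2]
  exact h

theorem sylow_normal {P : 𝓛.Obj} (hP : P.set = 𝓛.S) : (sylow P).Normal := by
  refine ⟨fun c hc g => ?_⟩
  have h1 := (el_conjEq (inv g)).mem_of_conj (by rw [hP]; exact hc) (el_conj_mem (inv g) c)
  rw [hP] at h1
  rw [mem_sylow]
  simpa using h1

namespace SignalizerFunctor

variable (𝓣 : 𝓛.SignalizerFunctor)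

/-- `Θ(P)` as a subgroup of the vertex group at `P`. -/
noncomputable def theta (P : 𝓛.Obj) : Subgroup (P ⟶ P) :=
  (𝓣.Θ P.toΔ).comap (vertexEquiv P).toMonoidHom

instance (P : 𝓛.Obj) : (𝓣.theta P).Normal := (𝓣.normal P.toΔ).comap _

variable {𝓣}

theorem mem_theta {P : 𝓛.Obj} {n : P ⟶ P} : n ∈ 𝓣.theta P ↔ vertexEquiv P n ∈ 𝓣.Θ P.toΔ :=
  Iff.rfl

theorem mem_theta_iff {P : 𝓛.Obj} {n : P ⟶ P} : n ∈ 𝓣.theta P ↔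
    el n ∈ Subtype.val '' (𝓣.Θ P.toΔ : Set (𝓛.normalizer P.toΔ.1)) := by
  rw [mem_theta]
  constructor
  · exact fun h => ⟨_, h, rfl⟩
  · rintro ⟨m, hm, h⟩
    rwa [show vertexEquiv P n = m from Subtype.ext h.symm]

theorem exists_mem_theta {P : 𝓛.Obj} {x : L}
    (hx : x ∈ Subtype.val '' (𝓣.Θ P.toΔ : Set (𝓛.normalizer P.toΔ.1))) :
    ∃ n ∈ 𝓣.theta P, el n = x := by
  obtain ⟨m, hm, rfl⟩ := hx
  exact ⟨(vertexEquiv P).symm m, by simpa [mem_theta] using hm, rfl⟩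

theorem theta_coprime (P : 𝓛.Obj) : (Nat.card (𝓣.theta P)).Coprime p := by
  have h : Nat.card (𝓣.theta P) = Nat.card (𝓣.Θ P.toΔ) :=
    Nat.card_congr ((vertexEquiv P).toEquiv.subtypeEquiv fun _ => Iff.rfl)
  rw [h]
  exact 𝓣.coprime _

theorem id_mem_theta (P : 𝓛.Obj) : 𝟙 P ∈ 𝓣.theta P := (𝓣.theta P).one_mem

theorem comp_mem_theta {P : 𝓛.Obj} {m n : P ⟶ P} (hm : m ∈ 𝓣.theta P) (hn : n ∈ 𝓣.theta P) :
    m ≫ n ∈ 𝓣.theta P := (𝓣.theta P).mul_mem hm hn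

theorem inv_mem_theta {P : 𝓛.Obj} {m : P ⟶ P} (hm : m ∈ 𝓣.theta P) : inv m ∈ 𝓣.theta P := by
  rw [← Groupoid.inv_eq_inv]
  exact (𝓣.theta P).inv_mem hm

theorem conj_mem_theta {P Q : 𝓛.Obj} {m : P ⟶ P} (hm : m ∈ 𝓣.theta P) (f : P ⟶ Q) :
    inv f ≫ m ≫ f ∈ 𝓣.theta Q :=
  mem_theta_iff.2 ((𝓣.conj P.toΔ Q.toΔ (el f) f.2).mem_of_conj (mem_theta_iff.1 hm)
    (el_conj_mem f m))

theorem conj_inv_mem_theta {P Q : 𝓛.Obj} {m : Q ⟶ Q} (hm : m ∈ 𝓣.theta Q) (f : P ⟶ Q) :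
    f ≫ m ≫ inv f ∈ 𝓣.theta P := by
  simpa using conj_mem_theta hm (inv f)

/-- `Θ` reverses inclusions. -/
theorem exists_theta_restrict {P Q : 𝓛.Obj} (h : P.set ⊆ Q.set) {n : Q ⟶ Q}
    (hn : n ∈ 𝓣.theta Q) : ∃ m ∈ 𝓣.theta P, el m = el n :=
  exists_mem_theta ((𝓣.balance P.toΔ Q.toΔ h).superset (mem_theta_iff.1 hn)).1

theorem exists_theta_extend {P Q : 𝓛.Obj} (h : P.set ⊆ Q.set) {n : P ⟶ P}
    (hn : n ∈ 𝓣.theta P) (hc : el n ∈ 𝓛.centralizer Q.set) : ∃ m ∈ 𝓣.theta Q, el m = el n :=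
  exists_mem_theta ((𝓣.balance P.toΔ Q.toΔ h).subset ⟨mem_theta_iff.1 hn, hc⟩)

variable (𝓣) in
/-- The elements `f` and `g` agree on `P` modulo `Θ`: both conjugate `P` to the same object, and
`f ∈ Θ(P) g`. -/
def Agree (P : 𝓛.Obj) (f g : L) : Prop :=
  ∃ (Q : 𝓛.Obj) (a b : P ⟶ Q), el a = f ∧ el b = g ∧ a ≫ inv b ∈ 𝓣.theta P

variable [Fact p.Prime]

/-- `Θ(P) ∩ S = 1`. -/
theorem eq_id_of_mem_theta_of_mem_sylow {P : 𝓛.Obj} {n : P ⟶ P} (hn : n ∈ 𝓣.theta P)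
    (hS : n ∈ sylow P) : n = 𝟙 P := by
  obtain ⟨k, hk⟩ := sylow_isPGroup P ⟨n, hS⟩
  have h1 : orderOf n ∣ p ^ k := orderOf_dvd_of_pow_eq_one (congrArg Subtype.val hk)
  have h2 : orderOf n ∣ Nat.card (𝓣.theta P) := Subgroup.orderOf_dvd_natCard _ hn
  have h3 : orderOf n = 1 :=
    Nat.eq_one_of_dvd_coprimes (Nat.Coprime.pow_right k (theta_coprime P)) h2 h1
  exact orderOf_eq_one_iff.1 h3

/-- If `f = n g` with `n ∈ Θ(P)`, and both `a ^ f` and `a ^ g` lie in `S`, then they coincide: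
they differ by an element of `Θ(Q) ∩ S`. -/
theorem conj_eq_conj {P Q : 𝓛.Obj} {f g : P ⟶ Q} (h : f ≫ inv g ∈ 𝓣.theta P) {a : P ⟶ P}
    (hf : inv f ≫ a ≫ f ∈ sylow Q) (hg : inv g ≫ a ≫ g ∈ sylow Q) :
    inv f ≫ a ≫ f = inv g ≫ a ≫ g := by
  have hn : inv g ≫ f ∈ 𝓣.theta Q := by simpa using conj_mem_theta h g
  have h1 : inv (inv g ≫ a ≫ g) ≫ (inv f ≫ a ≫ f) ∈ 𝓣.theta Q := by
    have h2 := comp_mem_theta (conj_mem_theta (inv_mem_theta hn) (inv g ≫ a ≫ g)) hn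
    simpa using h2
  have h2 : inv (inv g ≫ a ≫ g) ≫ (inv f ≫ a ≫ f) ∈ sylow Q := by
    refine (sylow Q).mul_mem ?_ hf
    rw [← Groupoid.inv_eq_inv]
    exact (sylow Q).inv_mem hg
  have h3 := eq_id_of_mem_theta_of_mem_sylow h1 h2
  exact ((IsIso.inv_comp_eq _).1 h3).trans (Category.comp_id _)

end SignalizerFunctor

end Locality

namespace Locality

open PartialGroup CategoryTheory

variable {p : ℕ} {L : Type*} {𝓛 : Locality p L}

variable (𝓛) in
/-- The subgroup `S_f` as an object. -/
def sourceObj (f : L) : 𝓛.Obj := ⟨⟨𝓛.source f, source_mem_Δ f⟩⟩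

@[simp] theorem sourceObj_set (f : L) : (𝓛.sourceObj f).set = 𝓛.source f := rfl

theorem Obj.isPSubgroup [Fact p.Prime] (P : 𝓛.Obj) : 𝓛.IsPSubgroup p P.set :=
  have := 𝓛.finite
  𝓛.S_pSubgroup.mono P.isSubgroup P.subset_S

/-- If the object `P` is properly contained in the object `R`, then `N_R(P)` is an object that
properly contains `P`. -/
theorem Obj.exists_normalizer [Fact p.Prime] {P R : 𝓛.Obj} (h : P.set ⊂ R.set) :
    ∃ A : 𝓛.Obj, P.set ⊂ A.set ∧ A.set = R.set ∩ 𝓛.normalizer P.set := by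
  have := 𝓛.finite
  obtain ⟨a, haR, haP, haN⟩ := R.isPSubgroup.exists_mem_normalizer P.isSubgroup h
  have hsub : P.set ⊆ R.set ∩ 𝓛.normalizer P.set :=
    fun x hx => ⟨h.1 hx, P.isSubgroup.subset_normalizer hx⟩
  refine ⟨⟨⟨R.set ∩ 𝓛.normalizer P.set, 𝓛.Δ_overgroup _ P.mem_Δ _
    (R.isSubgroup.inter (𝓛.normalizer_isSubgroup P.mem_Δ)) hsub
    fun x hx => R.subset_S hx.1⟩⟩, ⟨hsub, fun hs => haP (hs ⟨haR, haN⟩)⟩, rfl⟩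

/-- The value `x ^ f` for `x` in the intersection of `S_f` with the normalizer of `P` lies in
`S`. -/
theorem conj_mem_sylow {P Q : 𝓛.Obj} (f : P ⟶ Q) {x : P ⟶ P} (hx : el x ∈ 𝓛.source (el f)) :
    inv f ≫ x ≫ f ∈ sylow Q := by
  obtain ⟨-, y, hy, hxy⟩ := hx
  rw [mem_sylow, Part.mem_unique (el_conj_mem f x) hxy]
  exact hy

namespace SignalizerFunctor

variable {𝓣 : 𝓛.SignalizerFunctor}

theorem agree_el {P Q : 𝓛.Obj} {a b : P ⟶ Q} (h : a ≫ inv b ∈ 𝓣.theta P) :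
    𝓣.Agree P (el a) (el b) := ⟨Q, a, b, rfl, rfl, h⟩

theorem agree_theta_comp {P Q : 𝓛.Obj} {n : P ⟶ P} (hn : n ∈ 𝓣.theta P) (b : P ⟶ Q) :
    𝓣.Agree P (el (n ≫ b)) (el b) := agree_el (by simpa using hn)

theorem agree_comp_theta {P Q : 𝓛.Obj} {n : Q ⟶ Q} (hn : n ∈ 𝓣.theta Q) (b : P ⟶ Q) :
    𝓣.Agree P (el (b ≫ n)) (el b) := agree_el (by simpa using conj_inv_mem_theta hn b)

namespace Agree

variable {P : 𝓛.Obj} {f g h : L}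

theorem subset_left (H : 𝓣.Agree P f g) : P.set ⊆ 𝓛.source f := by
  obtain ⟨Q, a, b, rfl, rfl, -⟩ := H
  exact subset_source_el a

theorem subset_right (H : 𝓣.Agree P f g) : P.set ⊆ 𝓛.source g := by
  obtain ⟨Q, a, b, rfl, rfl, -⟩ := H
  exact subset_source_el b

theorem exists_left (H : 𝓣.Agree P f g) {Q : 𝓛.Obj} {b : P ⟶ Q} (hb : el b = g) :
    ∃ a : P ⟶ Q, el a = f ∧ a ≫ inv b ∈ 𝓣.theta P := by
  obtain ⟨R, a, b', rfl, rfl, h⟩ := H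
  obtain rfl := target_unique hb
  obtain rfl := el_injective hb
  exact ⟨a, rfl, h⟩

theorem refl (hf : P.set ⊆ 𝓛.source f) : 𝓣.Agree P f f := by
  obtain ⟨Q, a, rfl⟩ := exists_hom hf
  exact agree_el (by simpa using id_mem_theta P)

theorem symm (H : 𝓣.Agree P f g) : 𝓣.Agree P g f := by
  obtain ⟨Q, a, b, rfl, rfl, h⟩ := H
  exact agree_el (by simpa using inv_mem_theta h)

theorem exists_right (H : 𝓣.Agree P f g) {Q : 𝓛.Obj} {a : P ⟶ Q} (ha : el a = f) :
    ∃ b : P ⟶ Q, el b = g ∧ b ≫ inv a ∈ 𝓣.theta P :=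
  H.symm.exists_left ha

theorem trans (H : 𝓣.Agree P f g) (H' : 𝓣.Agree P g h) : 𝓣.Agree P f h := by
  obtain ⟨Q, b, c, rfl, rfl, h1⟩ := H'
  obtain ⟨a, rfl, h2⟩ := H.exists_left rfl
  exact agree_el (by simpa using comp_mem_theta h2 h1)

theorem mono (H : 𝓣.Agree P f g) {P' : 𝓛.Obj} (h : P'.set ⊆ P.set) : 𝓣.Agree P' f g := by
  obtain ⟨Q', b', hb'⟩ := exists_hom (h.trans H.subset_right)
  obtain ⟨Q, a, b, rfl, rfl, h1⟩ := H
  obtain ⟨m, hm, hmn⟩ := exists_theta_restrict h h1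
  have := agree_theta_comp hm b'
  rwa [el_comp_congr hmn hb', hb', Category.assoc, IsIso.inv_hom_id, Category.comp_id] at this

theorem comp {Q R : 𝓛.Obj} {a b : P ⟶ Q} {c d : Q ⟶ R} (H : 𝓣.Agree P (el a) (el b))
    (H' : 𝓣.Agree Q (el c) (el d)) : 𝓣.Agree P (el (a ≫ c)) (el (b ≫ d)) := by
  obtain ⟨a', ha', h1⟩ := H.exists_left rfl
  obtain rfl := el_injective ha'
  obtain ⟨c', hc', h2⟩ := H'.exists_left rfl
  obtain rfl := el_injective hc'
  have h3 := comp_mem_theta h1 (conj_inv_mem_theta h2 b)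
  exact agree_el (by simpa using h3)

theorem inv' {Q : 𝓛.Obj} {a b : P ⟶ Q} (H : 𝓣.Agree P (el a) (el b)) :
    𝓣.Agree Q (el (inv a)) (el (inv b)) := by
  obtain ⟨a', ha', h1⟩ := H.exists_left rfl
  obtain rfl := el_injective ha'
  refine agree_el ?_
  simpa using conj_mem_theta (inv_mem_theta h1) a'

variable [Fact p.Prime]

/-- Agreement on `P` extends to the objects between `P` and its normalizer on which both elements
are defined, since `f g⁻¹` centralizes them. -/
theorem extend_normalizer (H : 𝓣.Agree P f g) {A : 𝓛.Obj} (hPA : P.set ⊆ A.set)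
    (hA : A.set ⊆ 𝓛.normalizer P.set) (hf : A.set ⊆ 𝓛.source f) (hg : A.set ⊆ 𝓛.source g) :
    𝓣.Agree A f g := by
  obtain ⟨B, b', hb'⟩ := exists_hom hg
  obtain ⟨Q, a, b, rfl, rfl, h1⟩ := H
  have hc : el (a ≫ inv b) ∈ 𝓛.centralizer A.set := by
    intro x hx
    obtain ⟨c, rfl⟩ : ∃ c : P ⟶ P, el c = x := ⟨homMk x (hA hx), rfl⟩
    have h2 := conj_eq_conj h1 (conj_mem_sylow a (hf hx)) (conj_mem_sylow b (hg hx))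
    have h3 := el_conj_mem (a ≫ inv b) c
    have h4 : inv (a ≫ inv b) ≫ c ≫ a ≫ inv b = c := by
      have h5 := congrArg (fun z => b ≫ z ≫ inv b) h2
      simpa using h5
    rwa [h4] at h3
  obtain ⟨m, hm, hmn⟩ := exists_theta_extend hPA h1 hc
  have := agree_theta_comp hm b'
  rwa [el_comp_congr hmn hb', hb', Category.assoc, IsIso.inv_hom_id, Category.comp_id] at this

/-- Elements that agree on some object agree on every larger object on which both are defined. -/
theorem extend (H : 𝓣.Agree P f g) {R : 𝓛.Obj} (hPR : P.set ⊆ R.set)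
    (hf : R.set ⊆ 𝓛.source f) (hg : R.set ⊆ 𝓛.source g) : 𝓣.Agree R f g := by
  have := 𝓛.finite
  induction hk : (R.set \ P.set).ncard using Nat.strong_induction_on generalizing P with
  | _ k ih =>
    by_cases hRP : R.set ⊆ P.set
    · rwa [Obj.ext' (hPR.antisymm hRP)] at H
    · obtain ⟨A, hPA, hA⟩ := Obj.exists_normalizer (P := P) (R := R) ⟨hPR, hRP⟩
      have hAR : A.set ⊆ R.set := hA.trans_subset Set.inter_subset_left
      refine ih _ ?_ (H.extend_normalizer hPA.1 (hA.trans_subset Set.inter_subset_right)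
        (hAR.trans hf) (hAR.trans hg)) hAR rfl
      rw [← hk]
      refine Set.ncard_lt_ncard ?_ (Set.toFinite _)
      obtain ⟨a, haA, haP⟩ := Set.not_subset.1 hPA.2
      exact ⟨fun x hx => ⟨hx.1, fun h => hx.2 (hPA.1 h)⟩, fun h => (h ⟨hAR haA, haP⟩).2 haA⟩

end Agree

/-! ### The union of the signalizers -/

theorem mem_union {x : L} : x ∈ 𝓣.union ↔ ∃ P, ∃ n ∈ 𝓣.theta P, el n = x := by
  constructor
  · intro h
    obtain ⟨P, hP⟩ := Set.mem_iUnion.1 h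
    exact ⟨⟨P⟩, exists_mem_theta hP⟩
  · rintro ⟨P, n, hn, rfl⟩
    exact Set.mem_iUnion.2 ⟨P.toΔ, mem_theta_iff.1 hn⟩

theorem agree_one_iff {P : 𝓛.Obj} {x : L} :
    𝓣.Agree P x 𝓛.one ↔ ∃ n ∈ 𝓣.theta P, el n = x := by
  constructor
  · intro h
    obtain ⟨a, ha, h1⟩ := h.exists_left (el_id P)
    exact ⟨a, by simpa using h1, ha⟩
  · rintro ⟨n, hn, rfl⟩
    simpa [el_id] using agree_theta_comp hn (𝟙 P)

variable [Fact p.Prime]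

/-- If `x` lies in the union of the signalizers, then `x ∈ Θ(R)` for every object `R ≤ S_x`. -/
theorem exists_mem_theta_of_mem_union {x : L} (hx : x ∈ 𝓣.union) {R : 𝓛.Obj}
    (hR : R.set ⊆ 𝓛.source x) : ∃ n ∈ 𝓣.theta R, el n = x := by
  obtain ⟨P, n, hn, rfl⟩ := mem_union.1 hx
  have h1 : 𝓣.Agree (𝓛.sourceObj (el n)) (el n) 𝓛.one := by
    refine (agree_one_iff.2 ⟨n, hn, rfl⟩).extend (subset_source_el n) subset_rfl ?_
    rw [source_eq_S S_isSubgroup.one_mem]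
    exact source_subset _
  exact agree_one_iff.1 (h1.mono hR)

theorem exists_prod_mem_theta {P : 𝓛.Obj} {w : List L} (hw : ∀ x ∈ w, x ∈ 𝓣.union)
    (h : 𝓛.Via 𝓛.Δ P.set w) : ∃ n ∈ 𝓣.theta P, el n ∈ 𝓛.prod w := by
  induction w with
  | nil => exact ⟨𝟙 P, id_mem_theta P, one_mem⟩
  | cons f w ih =>
    obtain ⟨y, hy⟩ := Part.dom_iff_mem.1 (via_dom h)
    obtain ⟨hP, Q, hf, hv⟩ := h
    have hQ : Q ∈ 𝓛.Δ := mem_of_via hv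
    obtain ⟨n, hn, rfl⟩ := exists_mem_theta_of_mem_union (hw f (by simp))
      (subset_source hf P.subset_S (𝓛.Δ_subgroup Q hQ).2)
    obtain rfl := hf.target_unique (el_conjEq n)
    obtain ⟨m, hm, hmw⟩ := ih (fun x hx => hw x (by simp [hx])) hv
    refine ⟨n ≫ m, comp_mem_theta hn hm, ?_⟩
    have h1 : y ∈ 𝓛.prod [el n, el m] := by
      simpa using 𝓛.prod_assoc [el n] w [] _ y hmw (by simpa using hy)
    rwa [Part.mem_unique (el_comp_mem n m) h1]

variable (𝓣) in
theorem union_isPartialNormalPPrime : 𝓛.IsPartialNormalPPrime 𝓣.union := by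
  have hone : 𝓛.one ∈ 𝓣.union :=
    mem_union.2 ⟨𝓛.sourceObj 𝓛.one, 𝟙 _, id_mem_theta _, rfl⟩
  refine ⟨⟨⟨⟨_, hone⟩, fun g hg => ?_, fun w hw y hy => ?_⟩, fun g n hn y hy => ?_⟩, ?_⟩
  · obtain ⟨P, n, hn, rfl⟩ := mem_union.1 hg
    exact mem_union.2 ⟨P, inv n, inv_mem_theta hn, el_inv n⟩
  · obtain ⟨P, hP⟩ := (𝓛.dom_iff w).1 (dom_of_mem hy)
    obtain ⟨n, hn, hnw⟩ := exists_prod_mem_theta (P := ⟨⟨P, mem_of_via hP⟩⟩) hw hP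
    exact mem_union.2 ⟨_, n, hn, Part.mem_unique hnw hy⟩
  · obtain ⟨P, hP, Q, hPQ, hQ, R, hQR, hR, T, hRT, hT⟩ := (𝓛.dom_iff _).1 (dom_of_mem hy)
    obtain ⟨m, hm, rfl⟩ := exists_mem_theta_of_mem_union (R := ⟨⟨Q, hQ⟩⟩) hn
      (subset_source hQR (𝓛.Δ_subgroup Q hQ).2 (𝓛.Δ_subgroup R hR).2)
    obtain rfl := hQR.target_unique (el_conjEq m)
    let f : (⟨⟨R, hQ⟩⟩ : 𝓛.Obj) ⟶ ⟨⟨T, hT⟩⟩ := homMk g hRT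
    exact mem_union.2 ⟨_, _, conj_mem_theta hm f, Part.mem_unique (el_conj_mem f m) hy⟩
  · refine subset_antisymm ?_ (Set.singleton_subset_iff.2 ⟨hone, S_isSubgroup.one_mem⟩)
    rintro x ⟨hx, hxS⟩
    obtain ⟨P, n, hn, rfl⟩ := mem_union.1 hx
    rw [eq_id_of_mem_theta_of_mem_sylow hn hxS]
    rfl

end SignalizerFunctor

end Locality

/-! ### A conjugacy lemma of Sylow type -/

/-- If `G = N T` with `N` normal of order prime to `p` and `T` a `p`-subgroup, then every
`p`-subgroup is conjugate by an element of `N` to a subgroup of `T`. -/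
theorem Subgroup.exists_conj_mem_of_sup_eq_top {G : Type*} [Group G] [Finite G] {p : ℕ}
    [Fact p.Prime] {N T C : Subgroup G} [N.Normal] (hN : (Nat.card N).Coprime p)
    (hT : IsPGroup p T) (hC : IsPGroup p C) (h : N ⊔ T = ⊤) :
    ∃ n ∈ N, ∀ c ∈ C, n⁻¹ * c * n ∈ T := by
  obtain ⟨P, hP⟩ := hT.exists_le_sylow
  obtain ⟨R, hR⟩ := hC.exists_le_sylow
  have hPN : ∀ x ∈ P, x ∈ N → x = 1 := by
    intro x hx hxN
    obtain ⟨k, hk⟩ := P.isPGroup' ⟨x, hx⟩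
    have h1 : orderOf x ∣ p ^ k := orderOf_dvd_of_pow_eq_one (congrArg Subtype.val hk)
    exact orderOf_eq_one_iff.1 (Nat.eq_one_of_dvd_coprimes (Nat.Coprime.pow_right k hN)
      (Subgroup.orderOf_dvd_natCard _ hxN) h1)
  have hPT : ∀ x ∈ P, x ∈ T := by
    intro x hx
    obtain ⟨n, hn, t, ht, rfl⟩ := Subgroup.mem_sup_of_normal_left.1
      (h.symm ▸ Subgroup.mem_top x : x ∈ N ⊔ T)
    have hnP : n ∈ (P : Subgroup G) := by simpa using P.mul_mem hx (P.inv_mem (hP ht))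
    rw [hPN n hnP hn]
    simpa using ht
  obtain ⟨k, hk⟩ := MulAction.exists_smul_eq G R P
  obtain ⟨n, hn, t, ht, hnt⟩ := Subgroup.mem_sup_of_normal_left.1
      (h.symm ▸ Subgroup.mem_top k⁻¹ : k⁻¹ ∈ N ⊔ T)
  refine ⟨n, hn, fun c hc => ?_⟩
  have h1 : k * c * k⁻¹ ∈ T := by
    apply hPT
    rw [← hk]
    exact Subgroup.smul_mem_pointwise_smul _ (MulAut.conj k) _ (hR hc)
  have h2 : k = t⁻¹ * n⁻¹ := by rw [← mul_inv_rev, hnt, inv_inv]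
  have h3 := T.mul_mem (T.mul_mem ht h1) (T.inv_mem ht)
  rw [h2] at h3
  simpa [mul_assoc] using h3

/-- If `N` is normal of order prime to `p` and `T` is a `p`-subgroup, then every `p`-subgroup of
`N T` is conjugate by an element of `N` to a subgroup of `T`. -/
theorem Subgroup.exists_conj_mem_of_le_sup {G : Type*} [Group G] [Finite G] {p : ℕ}
    [Fact p.Prime] {N T C : Subgroup G} [N.Normal] (hN : (Nat.card N).Coprime p)
    (hT : IsPGroup p T) (hC : IsPGroup p C) (h : C ≤ N ⊔ T) :
    ∃ n ∈ N, ∀ c ∈ C, n⁻¹ * c * n ∈ T := by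
  have hN' : (Nat.card (N.subgroupOf (N ⊔ T))).Coprime p := by
    rwa [Nat.card_congr (Subgroup.subgroupOfEquivOfLe (le_sup_left : N ≤ N ⊔ T)).toEquiv]
  have htop : N.subgroupOf (N ⊔ T) ⊔ T.subgroupOf (N ⊔ T) = ⊤ := by
    rw [← Subgroup.subgroupOf_sup le_sup_left le_sup_right, Subgroup.subgroupOf_self]
  obtain ⟨n, hn, hnc⟩ := Subgroup.exists_conj_mem_of_sup_eq_top hN'
    hT.comap_subtype (hC.comap_subtype (K := N ⊔ T)) htop
  exact ⟨n, hn, fun c hc => hnc ⟨c, h hc⟩ hc⟩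

/-! ### Maximal extensions -/

namespace Locality

open PartialGroup CategoryTheory

variable {p : ℕ} {L : Type*} {𝓛 : Locality p L}

namespace SignalizerFunctor

variable {𝓣 : 𝓛.SignalizerFunctor}

/-- By Sylow's theorem in `Θ(Q) N_S(Q)`, a morphism `f` from `P` to `Q` can be modified by an
element of `Θ(Q)` such that all elements of `N_S(P)` that `f` conjugates into `Θ(Q) N_S(Q)` get
conjugated into `S`. -/
theorem exists_agree_source [Fact p.Prime] {P Q : 𝓛.Obj} (f : P ⟶ Q) :
    ∃ k : P ⟶ Q, 𝓣.Agree P (el k) (el f) ∧ ∀ c ∈ sylow P,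
      inv f ≫ c ≫ f ∈ 𝓣.theta Q ⊔ sylow Q → el c ∈ 𝓛.source (el k) := by
  have := 𝓛.finite
  obtain ⟨n, hn, h⟩ := Subgroup.exists_conj_mem_of_le_sup (N := 𝓣.theta Q) (T := sylow Q)
    (C := (sylow P).map (Groupoid.vertexGroupIsomOfMap f).toMonoidHom ⊓ (𝓣.theta Q ⊔ sylow Q))
    (theta_coprime Q) (sylow_isPGroup Q) (((sylow_isPGroup P).map _).to_le inf_le_left)
    inf_le_right
  refine ⟨f ≫ n, agree_comp_theta hn f, fun c hc hcf => ⟨hc, el (inv (f ≫ n) ≫ c ≫ f ≫ n), ?_,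
    el_conj_mem _ _⟩⟩
  have h1 := h (inv f ≫ c ≫ f) ⟨⟨c, hc, by simp⟩, hcf⟩
  have h2 : n⁻¹ * (inv f ≫ c ≫ f) * n = inv (f ≫ n) ≫ c ≫ f ≫ n := by
    simp
  rwa [h2] at h1

variable (𝓣) in
/-- The elements `f` and `g` agree on some object modulo `Θ`. -/
def Sim (f g : L) : Prop := ∃ P, 𝓣.Agree P f g

theorem Agree.sim {P : 𝓛.Obj} {f g : L} (h : 𝓣.Agree P f g) : 𝓣.Sim f g := ⟨P, h⟩

theorem Sim.refl (f : L) : 𝓣.Sim f f := ⟨𝓛.sourceObj f, Agree.refl subset_rfl⟩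

theorem Sim.symm {f g : L} (h : 𝓣.Sim f g) : 𝓣.Sim g f :=
  let ⟨P, hP⟩ := h
  ⟨P, hP.symm⟩

variable (𝓣) in
/-- The element `f` is a maximal extension: `S_f` contains `S_g` for all `g` that agree with `f`
on some object. -/
def IsTop (f : L) : Prop := ∀ g, 𝓣.Sim g f → 𝓛.source g ⊆ 𝓛.source f

variable [Fact p.Prime]

/-- Two elements that agree on some object agree on their common domain. -/
theorem Sim.exists_agree {f g : L} (h : 𝓣.Sim f g) :
    ∃ R : 𝓛.Obj, R.set = 𝓛.source f ∩ 𝓛.source g ∧ 𝓣.Agree R f g := by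
  obtain ⟨P, hP⟩ := h
  have hsub : P.set ⊆ 𝓛.source f ∩ 𝓛.source g := Set.subset_inter hP.subset_left hP.subset_right
  let R : 𝓛.Obj := ⟨⟨𝓛.source f ∩ 𝓛.source g, 𝓛.Δ_overgroup _ P.mem_Δ _
    ((source_isSubgroup f).inter (source_isSubgroup g)) hsub fun x hx => source_subset f hx.1⟩⟩
  exact ⟨R, rfl, hP.extend (R := R) hsub Set.inter_subset_left Set.inter_subset_right⟩

theorem Sim.agree {f g : L} (h : 𝓣.Sim f g) {P : 𝓛.Obj} (hf : P.set ⊆ 𝓛.source f)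
    (hg : P.set ⊆ 𝓛.source g) : 𝓣.Agree P f g := by
  obtain ⟨R, hR, h⟩ := h.exists_agree
  exact h.mono (by rw [hR]; exact Set.subset_inter hf hg)

/-- Similarity is not transitive in general, since the two objects involved may have an
intersection that is not an object. It is transitive along extensions. -/
theorem Sim.trans_of_subset {f g h : L} (H : 𝓣.Sim f g) (H' : 𝓣.Sim g h)
    (hs : 𝓛.source f ⊆ 𝓛.source g) (hs' : 𝓛.source g ⊆ 𝓛.source h) : 𝓣.Sim f h :=
  ((H.agree (P := 𝓛.sourceObj f) subset_rfl hs).trans (H'.agree hs (hs.trans hs'))).sim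

/-- Two elements that agree on some object have a common extension. -/
theorem Sim.exists_extension {f g : L} (h : 𝓣.Sim f g) : ∃ k, 𝓣.Sim f k ∧ 𝓣.Sim g k ∧
    𝓛.source f ⊆ 𝓛.source k ∧ 𝓛.source g ⊆ 𝓛.source k := by
  have := 𝓛.finite
  induction hm : (𝓛.S \ (𝓛.source f ∩ 𝓛.source g)).ncard using Nat.strong_induction_on
    generalizing f g with
  | _ m ih =>
    by_cases hfg : 𝓛.source f ⊆ 𝓛.source g
    · exact ⟨g, h, .refl g, hfg, subset_rfl⟩
    by_cases hgf : 𝓛.source g ⊆ 𝓛.source f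
    · exact ⟨f, .refl f, h.symm, subset_rfl, hgf⟩
    obtain ⟨I, hI, hIfg⟩ := h.exists_agree
    have hIf : I.set ⊂ (𝓛.sourceObj f).set :=
      ⟨hIfg.subset_left, fun hs => hfg fun x hx => (hI.subset (hs hx)).2⟩
    have hIg : I.set ⊂ (𝓛.sourceObj g).set :=
      ⟨hIfg.subset_right, fun hs => hgf fun x hx => (hI.subset (hs hx)).1⟩
    obtain ⟨A, hIA, hA⟩ := Obj.exists_normalizer hIf
    obtain ⟨B, hIB, hB⟩ := Obj.exists_normalizer hIg
    have hAf : A.set ⊆ 𝓛.source f := hA.trans_subset Set.inter_subset_left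
    have hBg : B.set ⊆ 𝓛.source g := hB.trans_subset Set.inter_subset_left
    obtain ⟨Q, a, b, haf, hbg, hab⟩ := id hIfg
    obtain ⟨k₀, hk₀, hsrc⟩ := exists_agree_source (𝓣 := 𝓣) a
    rw [haf] at hk₀
    have hAk : A.set ⊆ 𝓛.source (el k₀) := by
      intro x hx
      refine hsrc (homMk x (hA.subset hx).2) (A.subset_S hx) (Subgroup.mem_sup_right ?_)
      exact conj_mem_sylow a (by rw [haf]; exact hAf hx)
    have hBk : B.set ⊆ 𝓛.source (el k₀) := by
      intro x hx
      refine hsrc (homMk x (hB.subset hx).2) (B.subset_S hx) ?_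
      generalize hc : (homMk x (hB.subset hx).2 : I ⟶ I) = c
      have hcb : inv b ≫ c ≫ b ∈ sylow Q :=
        conj_mem_sylow b (by rw [hbg, ← hc]; exact hBg hx)
      have hn : inv b ≫ a ∈ 𝓣.theta Q := by simpa using conj_mem_theta hab b
      have h1 := Subgroup.mul_mem_sup (inv_mem_theta hn) hcb
      have h2 := (𝓣.theta Q ⊔ sylow Q).mul_mem h1 (Subgroup.mem_sup_left hn)
      simpa using h2
    -- the common domain of `f` and `k₀` contains `A`, and that of `k₁` and `g` contains `B`
    have key : ∀ {f' g' : L} {A : 𝓛.Obj}, I.set ⊂ A.set → A.set ⊆ 𝓛.source f' →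
        A.set ⊆ 𝓛.source g' → (𝓛.S \ (𝓛.source f' ∩ 𝓛.source g')).ncard < m := by
      intro f' g' A hIA hf' hg'
      rw [← hm, ← hI]
      refine Set.ncard_lt_ncard ?_ (Set.toFinite _)
      obtain ⟨x, hxA, hxI⟩ := Set.not_subset.1 hIA.2
      exact ⟨fun y hy => ⟨hy.1, fun hyI => hy.2 ⟨hf' (hIA.1 hyI), hg' (hIA.1 hyI)⟩⟩,
        fun hs => (hs ⟨A.subset_S hxA, hxI⟩).2 ⟨hf' hxA, hg' hxA⟩⟩
    obtain ⟨k₁, hfk₁, hk₀k₁, hsf, hsk₀⟩ := ih _ (key hIA hAf hAk) hk₀.symm.sim rfl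
    have hIk₁ : 𝓣.Agree I (el k₀) k₁ :=
      hk₀k₁.agree (hIA.1.trans hAk) ((hIA.1.trans hAk).trans hsk₀)
    obtain ⟨k₂, hk₁k₂, hgk₂, hsk₁, hsg⟩ := ih _ (key hIB (hBk.trans hsk₀) hBg)
      (hIk₁.symm.trans (hk₀.trans hIfg)).sim rfl
    exact ⟨k₂, hfk₁.trans_of_subset hk₁k₂ hsf hsk₁, hgk₂, hsf.trans hsk₁, hsg⟩

theorem exists_isTop (f : L) : ∃ k, 𝓣.IsTop k ∧ 𝓣.Sim f k ∧ 𝓛.source f ⊆ 𝓛.source k := by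
  have := 𝓛.finite
  have hfin : {k | 𝓣.Sim f k ∧ 𝓛.source f ⊆ 𝓛.source k}.Finite := Set.toFinite _
  obtain ⟨k, ⟨hfk, hs⟩, hk⟩ :=
    Set.exists_max_image _ (fun k => (𝓛.source k).ncard) hfin ⟨f, .refl f, subset_rfl⟩
  refine ⟨k, fun g hg => ?_, hfk, hs⟩
  obtain ⟨l, hgl, hkl, hsg, hsk⟩ := hg.exists_extension
  have h1 := hk l ⟨hfk.trans_of_subset hkl hs hsk, hs.trans hsk⟩
  rwa [← Set.eq_of_subset_of_ncard_le hsk h1 (Set.toFinite _)] at hsg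

/-- Similarity to a maximal extension is transitive. -/
theorem Sim.trans_isTop {f g k : L} (h : 𝓣.Sim f g) (hgk : 𝓣.Sim g k) (hk : 𝓣.IsTop k) :
    𝓣.Sim f k := by
  obtain ⟨P, hP⟩ := h
  exact (hP.trans (hgk.agree hP.subset_right (hP.subset_right.trans (hk g hgk)))).sim

theorem IsTop.sim_of_sim {f k l : L} (hk : 𝓣.IsTop k) (hl : 𝓣.IsTop l) (h : 𝓣.Sim f k)
    (h' : 𝓣.Sim f l) : 𝓣.Sim k l :=
  (h.symm.agree (P := 𝓛.sourceObj f) (hk f h) subset_rfl).sim.trans_isTop h' hl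

/-! ### Maximal cosets -/

theorem mem_coset_iff {f g : L} : g ∈ 𝓛.coset 𝓣.union f ↔ 𝓣.Sim g f := by
  constructor
  · rintro ⟨n, hn, hg⟩
    obtain ⟨P, hP, Q, hPQ, hQ, R, hQR, hR⟩ := (𝓛.dom_iff _).1 (dom_of_mem hg)
    replace hR : R ∈ 𝓛.Δ := hR
    obtain ⟨m, hm, rfl⟩ := exists_mem_theta_of_mem_union (R := ⟨⟨P, hP⟩⟩) hn
      (subset_source hPQ (𝓛.Δ_subgroup P hP).2 (𝓛.Δ_subgroup Q hQ).2)
    obtain rfl := hPQ.target_unique (el_conjEq m)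
    let b : (⟨⟨Q, hP⟩⟩ : 𝓛.Obj) ⟶ ⟨⟨R, hR⟩⟩ := homMk f hQR
    have h1 := agree_theta_comp hm b
    rw [Part.mem_unique (el_comp_mem m b) hg] at h1
    exact h1.sim
  · rintro ⟨P, Q, a, b, rfl, rfl, h⟩
    refine ⟨_, mem_union.2 ⟨P, _, h, rfl⟩, ?_⟩
    simpa using el_comp_mem (a ≫ inv b) b

theorem coset_subset_coset {f k : L} (h : 𝓣.Sim f k) (hk : 𝓣.IsTop k) :
    𝓛.coset 𝓣.union f ⊆ 𝓛.coset 𝓣.union k := fun _ hg =>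
  mem_coset_iff.2 ((mem_coset_iff.1 hg).trans_isTop h hk)

theorem isMaximalCoset {k : L} (hk : 𝓣.IsTop k) :
    𝓛.IsMaximalCoset 𝓣.union (𝓛.coset 𝓣.union k) := by
  refine ⟨⟨k, rfl⟩, ?_⟩
  rintro _ ⟨f, rfl⟩ hs
  exact coset_subset_coset (mem_coset_iff.1 (hs (mem_coset_iff.2 (.refl k)))).symm hk

theorem exists_isTop_of_isMaximalCoset {C : Set L} (hC : 𝓛.IsMaximalCoset 𝓣.union C) :
    ∃ k, 𝓣.IsTop k ∧ C = 𝓛.coset 𝓣.union k := by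
  obtain ⟨f, rfl⟩ := hC.1
  obtain ⟨k, hk, hfk, -⟩ := exists_isTop (𝓣 := 𝓣) f
  have h1 := coset_subset_coset hfk hk
  exact ⟨k, hk, h1.antisymm (hC.2 ⟨k, rfl⟩ h1)⟩

variable (𝓣) in
/-- A maximal extension that represents a given maximal coset. -/
noncomputable def rep (C : 𝓛.Quotient 𝓣.union) : L :=
  (exists_isTop_of_isMaximalCoset C.2).choose

theorem rep_isTop (C : 𝓛.Quotient 𝓣.union) : 𝓣.IsTop (𝓣.rep C) :=
  (exists_isTop_of_isMaximalCoset C.2).choose_spec.1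

theorem mem_iff_sim_rep {C : 𝓛.Quotient 𝓣.union} {g : L} : g ∈ C.1 ↔ 𝓣.Sim g (𝓣.rep C) := by
  conv_lhs => rw [(exists_isTop_of_isMaximalCoset C.2).choose_spec.2]
  exact mem_coset_iff

variable (𝓣) in
/-- The natural map, which sends `g` to the coset of a maximal extension of `g`. -/
noncomputable def proj (g : L) : 𝓛.Quotient 𝓣.union :=
  ⟨_, isMaximalCoset (exists_isTop (𝓣 := 𝓣) g).choose_spec.1⟩

theorem sim_rep_proj (g : L) : 𝓣.Sim g (𝓣.rep (𝓣.proj g)) :=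
  mem_iff_sim_rep.1 (mem_coset_iff.2 (exists_isTop (𝓣 := 𝓣) g).choose_spec.2.1)

theorem source_subset_rep_proj (g : L) : 𝓛.source g ⊆ 𝓛.source (𝓣.rep (𝓣.proj g)) :=
  rep_isTop _ g (sim_rep_proj g)

theorem eq_proj_of_sim_rep {C : 𝓛.Quotient 𝓣.union} {g : L} (h : 𝓣.Sim g (𝓣.rep C)) :
    C = 𝓣.proj g := by
  have h1 := (rep_isTop C).sim_of_sim (rep_isTop _) h (sim_rep_proj g)
  apply Subtype.ext
  ext x
  rw [mem_iff_sim_rep, mem_iff_sim_rep]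
  exact ⟨fun hx => hx.trans_isTop h1 (rep_isTop _), fun hx => hx.trans_isTop h1.symm (rep_isTop _)⟩

variable (𝓣) in
theorem proj_isNaturalMap : 𝓛.IsNaturalMap 𝓣.union 𝓣.proj := fun g C =>
  ⟨fun h => eq_proj_of_sim_rep (mem_iff_sim_rep.1 h), fun h => by
    rw [h, mem_iff_sim_rep]
    exact sim_rep_proj g⟩

@[simp] theorem proj_rep (C : 𝓛.Quotient 𝓣.union) : 𝓣.proj (𝓣.rep C) = C :=
  (eq_proj_of_sim_rep (.refl _)).symm

theorem proj_surjective : Function.Surjective 𝓣.proj := fun C => ⟨_, proj_rep C⟩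

theorem Sim.proj_eq {f g : L} (h : 𝓣.Sim f g) : 𝓣.proj f = 𝓣.proj g :=
  (eq_proj_of_sim_rep (h.trans_isTop (sim_rep_proj g) (rep_isTop _))).symm

/-- Elements with the same image in the quotient agree on their common domain, provided that the
latter contains an object. -/
theorem agree_of_proj_eq {f g : L} (h : 𝓣.proj f = 𝓣.proj g) {P : 𝓛.Obj}
    (hf : P.set ⊆ 𝓛.source f) (hg : P.set ⊆ 𝓛.source g) : 𝓣.Agree P f g :=
  ((sim_rep_proj f).agree hf (hf.trans (source_subset_rep_proj f))).trans
    (h ▸ ((sim_rep_proj g).agree hg (hg.trans (source_subset_rep_proj g))).symm)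

theorem proj_injOn : Set.InjOn 𝓣.proj 𝓛.S := by
  intro s hs t ht h
  have hs' : (𝓛.sourceObj 𝓛.one).set ⊆ 𝓛.source s := by
    rw [source_eq_S hs]; exact source_subset _
  have ht' : (𝓛.sourceObj 𝓛.one).set ⊆ 𝓛.source t := by
    rw [source_eq_S ht]; exact source_subset _
  obtain ⟨Q, a, b, rfl, rfl, hab⟩ := agree_of_proj_eq h hs' ht'
  have h1 : a ≫ inv b ∈ sylow (𝓛.sourceObj 𝓛.one) := by
    refine S_isSubgroup.mul_mem hs ?_ (el_comp_mem a (inv b))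
    rw [el_inv]
    exact S_isSubgroup.inv_mem _ ht
  have h2 := eq_id_of_mem_theta_of_mem_sylow hab h1
  rw [(IsIso.comp_inv_eq b).1 h2, Category.id_comp]

end SignalizerFunctor

end Locality

/-! ### The partial group structure of the quotient -/

namespace Locality

open PartialGroup CategoryTheory

variable {p : ℕ} {L : Type*} {𝓛 : Locality p L}

namespace SignalizerFunctor

variable [Fact p.Prime] {𝓣 : 𝓛.SignalizerFunctor}

/-- If all letters of a word that is defined via objects starting with `P` are replaced by maximal
extensions, then the new word is defined via the same objects, and the products agree on `P`. -/
theorem exists_prod_map_rep {P : 𝓛.Obj} {w : List L} (h : 𝓛.Via 𝓛.Δ P.set w) :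
    𝓛.Via 𝓛.Δ P.set (w.map fun g => 𝓣.rep (𝓣.proj g)) ∧
    ∃ x ∈ 𝓛.prod w, ∃ y ∈ 𝓛.prod (w.map fun g => 𝓣.rep (𝓣.proj g)), 𝓣.Agree P x y := by
  induction w generalizing P with
  | nil =>
    refine ⟨h, _, one_mem, _, one_mem, Agree.refl ?_⟩
    rw [source_eq_S S_isSubgroup.one_mem]
    exact P.subset_S
  | cons f w ih =>
    obtain ⟨z, hz⟩ := Part.dom_iff_mem.1 (via_dom h)
    obtain ⟨hP, Q, hf, hv⟩ := h
    have hQ : Q ∈ 𝓛.Δ := mem_of_via hv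
    let a₀ : P ⟶ ⟨⟨Q, hQ⟩⟩ := homMk f hf
    have hsrc : P.set ⊆ 𝓛.source f := subset_source_el a₀
    obtain ⟨b₀, hb₀, h₀⟩ := ((sim_rep_proj (𝓣 := 𝓣) f).agree hsrc
      (hsrc.trans (source_subset_rep_proj f))).exists_right (a := a₀) rfl
    obtain ⟨hv', x, hx, y, hy, hxy⟩ := ih (P := ⟨⟨Q, hQ⟩⟩) hv
    have hb : 𝓛.ConjEq (𝓣.rep (𝓣.proj f)) P.set Q := by
      rw [← hb₀]
      exact el_conjEq b₀
    have hvia := via_cons hP hb hv'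
    obtain ⟨z', hz'⟩ := Part.dom_iff_mem.1 (via_dom hvia)
    obtain ⟨R, a, b, rfl, rfl, h₁⟩ := hxy
    have h1 : z ∈ 𝓛.prod [f, el a] := by
      simpa using 𝓛.prod_assoc [f] w [] _ z hx (by simpa using hz)
    have h2 : z' ∈ 𝓛.prod [𝓣.rep (𝓣.proj f), el b] := by
      simpa using 𝓛.prod_assoc [_] _ [] _ z' hy (by simpa using hz')
    refine ⟨hvia, z, hz, z', hz', ?_⟩
    have h3 := (agree_el h₀).symm.comp (agree_el h₁)
    rwa [Part.mem_unique (el_comp_mem a₀ a) h1, Part.mem_unique (el_comp_mem b₀ b) (by rwa [hb₀])]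
      at h3

theorem exists_mem_prod_map_rep {w : List L} {x : L} (h : x ∈ 𝓛.prod w) :
    ∃ y ∈ 𝓛.prod ((w.map 𝓣.proj).map 𝓣.rep), 𝓣.proj y = 𝓣.proj x := by
  obtain ⟨P, hP⟩ := (𝓛.dom_iff w).1 (dom_of_mem h)
  obtain ⟨-, x', hx', y, hy, hxy⟩ :=
    exists_prod_map_rep (𝓣 := 𝓣) (P := ⟨⟨P, mem_of_via hP⟩⟩) hP
  rw [Part.mem_unique h hx']
  exact ⟨y, by simpa [Function.comp_def] using hy, hxy.sim.symm.proj_eq⟩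

/-- Similar elements have similar inverses. -/
theorem proj_inv_rep_proj (g : L) :
    𝓣.proj (𝓛.inv (𝓣.rep (𝓣.proj g))) = 𝓣.proj (𝓛.inv g) := by
  obtain ⟨P, Q, a, b, ha, hb, h⟩ := sim_rep_proj (𝓣 := 𝓣) g
  have h1 := (agree_el h).inv'.sim.proj_eq
  rw [el_inv, el_inv, ha, hb] at h1
  exact h1.symm

variable (𝓣) in
/-- The partial group structure of the quotient: a word of maximal cosets is multiplied by
multiplying the maximal extensions that represent its letters. -/
noncomputable def quotient : PartialGroup (𝓛.Quotient 𝓣.union) where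
  prod w := (𝓛.prod (w.map 𝓣.rep)).map 𝓣.proj
  inv C := 𝓣.proj (𝓛.inv (𝓣.rep C))
  nonempty := ⟨𝓣.proj 𝓛.one⟩
  inv_inv C := by rw [proj_inv_rep_proj, 𝓛.inv_inv, proj_rep]
  dom_append u v h := 𝓛.dom_append _ _ (by rw [← List.map_append]; exact h)
  prod_single C := (Part.mem_map_iff _).2 ⟨_, 𝓛.prod_single _, proj_rep C⟩
  prod_assoc u v w x y hx hy := by
    obtain ⟨a, ha, rfl⟩ := (Part.mem_map_iff _).1 hx
    obtain ⟨b, hb, rfl⟩ := (Part.mem_map_iff _).1 hy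
    have h1 := 𝓛.prod_assoc (u.map 𝓣.rep) (v.map 𝓣.rep) (w.map 𝓣.rep) a b ha
      (by simpa using hb)
    obtain ⟨c, hc, hcb⟩ := exists_mem_prod_map_rep (𝓣 := 𝓣) h1
    exact (Part.mem_map_iff _).2 ⟨c, by simpa [Function.comp_def] using hc, hcb⟩
  prod_inv w h := by
    obtain ⟨c, hc, hc1⟩ := exists_mem_prod_map_rep (𝓣 := 𝓣) (prod_inv_mem h)
    exact ⟨_, (Part.mem_map_iff _).2 ⟨_, one_mem, rfl⟩,
      (Part.mem_map_iff _).2 ⟨c, by simpa [Function.comp_def] using hc, hc1⟩⟩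

variable (𝓣) in
theorem proj_isHom : 𝓛.IsHom 𝓣.quotient 𝓣.proj := fun _ _ hx =>
  (Part.mem_map_iff _).2 (exists_mem_prod_map_rep hx)

variable (𝓣) in
theorem proj_isProjection : 𝓛.IsProjection 𝓣.quotient 𝓣.proj :=
  ⟨proj_isHom 𝓣, fun w h => ⟨w.map 𝓣.rep, h, by simp [Function.comp_def]⟩⟩

/-- Conjugation in the quotient between elements of the image of `S` lifts to conjugation by
maximal extensions. -/
theorem conj_rep {C : 𝓛.Quotient 𝓣.union} {x y : L} (hx : x ∈ 𝓛.S) (hy : y ∈ 𝓛.S)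
    (h : 𝓣.proj y ∈ 𝓣.quotient.conj C (𝓣.proj x)) : y ∈ 𝓛.conj (𝓣.rep C) x := by
  have := 𝓛.finite
  have hhom := proj_isHom 𝓣
  suffices hxs : x ∈ 𝓛.source (𝓣.rep C) by
    obtain ⟨-, y', hy', hxy'⟩ := hxs
    have h1 := hhom.map_conj hxy'
    rw [proj_rep] at h1
    rwa [proj_injOn hy hy' (Part.mem_unique h h1)]
  obtain ⟨Y, a, ha⟩ := exists_hom (f := 𝓣.rep C) (P := 𝓛.sourceObj (𝓣.rep C)) subset_rfl
  generalize hX : 𝓛.sourceObj (𝓣.rep C) = X at a ha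
  have hXs : X.set = 𝓛.source (𝓣.rep C) := by rw [← hX]; rfl
  obtain ⟨X', c, hc⟩ := exists_hom (f := x) (P := X) (by rw [source_eq_S hx]; exact X.subset_S)
  obtain ⟨Y', d, hd⟩ := exists_hom (f := y) (P := Y) (by rw [source_eq_S hy]; exact Y.subset_S)
  -- the element `x⁻¹ f y` has the same image as `f`, and is defined on the conjugate of `S_f`
  -- by `x`, which is therefore `S_f`
  have hproj : 𝓣.proj (el (inv c ≫ a ≫ d)) = C := by
    have h1 := hhom _ _ (el_comp₃_mem (inv c) a d)
    have h2 := conj_swap h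
    rw [← hhom.map_inv] at h2
    rw [el_inv, hc, ha, hd] at h1
    exact Part.mem_unique h1 (by simpa using h2)
  have hsim : 𝓣.Sim (el (inv c ≫ a ≫ d)) (𝓣.rep C) := by
    have h1 := sim_rep_proj (𝓣 := 𝓣) (el (inv c ≫ a ≫ d))
    rwa [hproj] at h1
  have hsub : X'.set ⊆ X.set := by
    rw [hXs]
    exact (subset_source_el _).trans (rep_isTop C _ hsim)
  obtain rfl : X' = X := Obj.ext' ((el_conjEq c).eq_of_subset hsub)
  obtain ⟨a', ha', -⟩ := (hsim.agree (subset_source_el _) hXs.subset).exists_left ha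
  obtain rfl := target_unique ha'
  -- hence `x ^ f` is defined and differs from `y` by an element of `Θ`
  have hu := hhom.map_conj (el_conj_mem a c)
  rw [ha, hc, proj_rep] at hu
  obtain ⟨u, hu', hud⟩ := (agree_of_proj_eq (P := Y) (f := el (inv a ≫ c ≫ a)) (g := y)
    (Part.mem_unique hu h) (subset_source_el _)
    (by rw [source_eq_S hy]; exact Y.subset_S)).exists_left hd
  obtain rfl := el_injective hu'
  obtain ⟨k, hk, hsrc⟩ := exists_agree_source (𝓣 := 𝓣) a
  rw [ha] at hk
  rw [← hc]
  refine rep_isTop C _ hk.sim (hsrc c (by rw [mem_sylow, hc]; exact hx) ?_)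
  have hd' : d ∈ sylow Y := by rw [mem_sylow, hd]; exact hy
  have h1 := Subgroup.mul_mem_sup hud hd'
  simpa using h1

theorem conjEq_rep {C : 𝓛.Quotient 𝓣.union} {P Q : Set L} (hP : P ⊆ 𝓛.S) (hQ : Q ⊆ 𝓛.S)
    (h : 𝓣.quotient.ConjEq C (𝓣.proj '' P) (𝓣.proj '' Q)) : 𝓛.ConjEq (𝓣.rep C) P Q := by
  refine conjEq_of_forall (fun x hx => ?_) fun y hy => ?_
  · obtain ⟨_, ⟨y, hy, rfl⟩, hxy⟩ := h.exists_mem ⟨x, hx, rfl⟩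
    exact ⟨y, hy, conj_rep (hP hx) (hQ hy) hxy⟩
  · obtain ⟨_, ⟨x, hx, rfl⟩, hxy⟩ := h.2.superset ⟨y, hy, rfl⟩
    exact ⟨x, hx, conj_rep (hP hx) (hQ hy) hxy⟩

/-! ### The quotient is a locality -/

theorem image_inter_preimage {T : Set (𝓛.Quotient 𝓣.union)} (h : T ⊆ 𝓣.proj '' 𝓛.S) :
    𝓣.proj '' (𝓛.S ∩ 𝓣.proj ⁻¹' T) = T := by
  rw [Set.image_inter_preimage, Set.inter_eq_right]
  exact h

theorem preimage_isSubgroup {T : Set (𝓛.Quotient 𝓣.union)} (h : 𝓣.quotient.IsSubgroup T) :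
    𝓛.IsSubgroup (𝓛.S ∩ 𝓣.proj ⁻¹' T) := by
  have hS : 𝓛.IsSubgroup 𝓛.S := S_isSubgroup
  have hhom := proj_isHom 𝓣
  refine hS.of_subset Set.inter_subset_left ⟨hS.one_mem, ?_⟩ (fun g hg => ⟨hS.inv_mem g hg.1, ?_⟩)
    fun x hx y hy z hz => ⟨hS.mul_mem hx.1 hy.1 hz, h.mul_mem hx.2 hy.2 (hhom _ _ hz)⟩
  · rw [Set.mem_preimage, hhom.map_one]
    exact h.one_mem
  · rw [Set.mem_preimage, hhom.map_inv]
    exact h.inv_mem _ hg.2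

theorem via_map_proj {P : Set L} {w : List L} (h : 𝓛.Via 𝓛.Δ P w) :
    𝓣.quotient.Via ((fun P => 𝓣.proj '' P) '' 𝓛.Δ) (𝓣.proj '' P) (w.map 𝓣.proj) := by
  induction w generalizing P with
  | nil => exact ⟨P, h, rfl⟩
  | cons f w ih =>
    obtain ⟨hP, Q, hf, hv⟩ := h
    exact ⟨⟨P, hP, rfl⟩, 𝓣.proj '' Q, (proj_isHom 𝓣).map_conjEq hf, ih hv⟩

theorem via_map_rep {P : Set L} (hP : P ∈ 𝓛.Δ) {w : List (𝓛.Quotient 𝓣.union)}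
    (h : 𝓣.quotient.Via ((fun P => 𝓣.proj '' P) '' 𝓛.Δ) (𝓣.proj '' P) w) :
    𝓛.Via 𝓛.Δ P (w.map 𝓣.rep) := by
  induction w generalizing P with
  | nil => exact hP
  | cons f w ih =>
    obtain ⟨-, Q', hf, hv⟩ := h
    obtain ⟨Q, hQ, rfl⟩ := mem_of_via hv
    exact ⟨hP, Q, conjEq_rep (𝓛.Δ_subgroup P hP).2 (𝓛.Δ_subgroup Q hQ).2 hf, ih hQ hv⟩

/-- The group `S` contains all `p`-elements of its normalizer. -/
theorem mem_sylow_of_pow_eq_one {P : 𝓛.Obj} (hP : P.set = 𝓛.S) {b : P ⟶ P} {k : ℕ}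
    (hb : b ^ p ^ k = 1) : b ∈ sylow P := by
  have := 𝓛.finite
  have hn := sylow_normal hP
  have hz : IsPGroup p (Subgroup.zpowers b) := by
    refine IsPGroup.of_card_dvd_pow (n := k) ?_
    rw [Nat.card_zpowers]
    exact orderOf_dvd_of_pow_eq_one hb
  have h1 := ((sylow_isPGroup P).to_sup_of_normal_left hz).map (vertexEquiv P).toMonoidHom
  have h2 := IsPSubgroup.image_subgroup (𝓛.normalizer_isSubgroup P.mem_Δ) _ h1
  have h3 := 𝓛.S_maximal _ h2 fun s hs => by
    obtain ⟨c, rfl⟩ : ∃ c : P ⟶ P, el c = s :=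
      ⟨homMk s (P.isSubgroup.subset_normalizer (by rwa [hP])), rfl⟩
    exact ⟨_, ⟨c, Subgroup.mem_sup_left hs, rfl⟩, rfl⟩
  rw [mem_sylow, ← h3]
  exact ⟨_, ⟨b, Subgroup.mem_sup_right (Subgroup.mem_zpowers b), rfl⟩, rfl⟩

theorem quotient_S_maximal (T : Set (𝓛.Quotient 𝓣.union)) (hT : 𝓣.quotient.IsPSubgroup p T)
    (hST : 𝓣.proj '' 𝓛.S ⊆ T) : T = 𝓣.proj '' 𝓛.S := by
  have := 𝓛.finite
  have : Finite (𝓛.Quotient 𝓣.union) := Subtype.finite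
  have hhom := proj_isHom 𝓣
  have hS := hhom.image_isSubgroup (S_isSubgroup (𝓛 := 𝓛))
  by_contra hne
  obtain ⟨t, htT, htS, htN⟩ := hT.exists_mem_normalizer hS ⟨hST, fun h => hne (h.antisymm hST)⟩
  let P : 𝓛.Obj := ⟨⟨𝓛.S, S_mem_Δ⟩⟩
  let a : P ⟶ P := homMk (𝓣.rep t) (conjEq_rep subset_rfl subset_rfl htN)
  let := hT.1.group
  have hpow : ∀ n, 𝓣.proj (el (a ^ n)) = ((⟨t, htT⟩ : T) ^ n : T).1 := by
    intro n
    have h1 := hhom _ _ (el_pow_mem a n)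
    rw [List.map_replicate, show 𝓣.proj (el a) = t from proj_rep t] at h1
    exact Part.mem_unique h1 (hT.1.coe_pow_mem ⟨t, htT⟩ n)
  obtain ⟨k, hk⟩ := hT.isPGroup ⟨t, htT⟩
  have h1 : a ^ p ^ k ∈ 𝓣.theta P := by
    have h2 : 𝓣.proj (el (a ^ p ^ k)) = 𝓣.proj 𝓛.one := by
      rw [hpow, hk, hhom.map_one]
      rfl
    obtain ⟨n, hn, hna⟩ := agree_one_iff.1 (agree_of_proj_eq (P := P) h2 (subset_source_el _)
      (by rw [source_eq_S S_isSubgroup.one_mem]; exact P.subset_S))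
    rwa [← el_injective hna]
  have h2 : (a ^ Nat.card (𝓣.theta P)) ^ p ^ k = 1 := by
    rw [← pow_mul, mul_comm, pow_mul]
    exact congrArg Subtype.val (pow_card_eq_one' (x := (⟨_, h1⟩ : 𝓣.theta P)))
  have h3 : (⟨t, htT⟩ : T) ^ Nat.card (𝓣.theta P) ∈ hT.1.subgroupIn hS := by
    rw [IsSubgroup.mem_subgroupIn, ← hpow]
    exact ⟨_, mem_sylow_of_pow_eq_one rfl h2, rfl⟩
  have h4 : (Nat.card (𝓣.theta P)).Coprime (orderOf (⟨t, htT⟩ : T)) :=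
    (Nat.Coprime.pow_right k (theta_coprime P)).coprime_dvd_right (orderOf_dvd_of_pow_eq_one hk)
  obtain ⟨m, hm⟩ := exists_pow_eq_self_of_coprime h4
  have h5 := (hT.1.subgroupIn hS).pow_mem h3 m
  rw [hm] at h5
  exact htS h5

variable (𝓣) in
/-- The quotient of the locality by the union of the signalizers. -/
noncomputable def quotientLocality : Locality p (𝓛.Quotient 𝓣.union) where
  toPartialGroup := 𝓣.quotient
  finite := have := 𝓛.finite; Subtype.finite
  S := 𝓣.proj '' 𝓛.S
  Δ := (fun P => 𝓣.proj '' P) '' 𝓛.Δ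
  S_pSubgroup := by
    refine ⟨(proj_isHom 𝓣).image_isSubgroup S_isSubgroup, ?_⟩
    rw [Nat.card_image_of_injOn proj_injOn]
    exact 𝓛.S_pSubgroup.2
  Δ_nonempty := 𝓛.Δ_nonempty.image _
  Δ_subgroup := by
    rintro _ ⟨P, hP, rfl⟩
    exact ⟨(proj_isHom 𝓣).image_isSubgroup (𝓛.Δ_subgroup P hP).1,
      Set.image_mono (𝓛.Δ_subgroup P hP).2⟩
  S_maximal := quotient_S_maximal
  dom_iff w := by
    constructor
    · intro h
      obtain ⟨P, hP⟩ := (𝓛.dom_iff _).1 (show (𝓛.prod (w.map 𝓣.rep)).Dom from h)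
      exact ⟨_, by simpa [Function.comp_def] using via_map_proj (𝓣 := 𝓣) hP⟩
    · rintro ⟨_, h⟩
      obtain ⟨P, hP, rfl⟩ := mem_of_via h
      exact via_dom (via_map_rep hP h)
  Δ_overgroup := by
    rintro _ ⟨P, hP, rfl⟩ Q hQ hPQ hQS
    refine ⟨_, 𝓛.Δ_overgroup P hP _ (preimage_isSubgroup hQ) (fun x hx => ?_)
      Set.inter_subset_left, image_inter_preimage hQS⟩
    exact ⟨(𝓛.Δ_subgroup P hP).2 hx, hPQ ⟨x, hx, rfl⟩⟩
  Δ_conj := by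
    rintro _ ⟨P, hP, rfl⟩ C Q h hQS
    rw [← image_inter_preimage hQS] at h
    exact ⟨_, 𝓛.Δ_conj P hP _ _ (conjEq_rep (𝓛.Δ_subgroup P hP).2 Set.inter_subset_left h)
      Set.inter_subset_left, image_inter_preimage hQS⟩

end SignalizerFunctor

end Locality

/-! ### Transport of fusion systems -/

namespace FusionSystem

variable {S T : Type*} [Group S] [Group T]

/-- The isomorphism from `P` to its image under `e`. -/
def mapEquiv (e : S ≃* T) (P : Subgroup S) : P ≃* P.map e.toMonoidHom := e.subgroupMap P

theorem coe_mapEquiv (e : S ≃* T) (P : Subgroup S) (x : P) : (mapEquiv e P x : T) = e x := rfl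

/-- The homomorphism between the images of `P` and `Q` under the isomorphism `e` that corresponds
to `φ`. -/
def transportHom (e : S ≃* T) {P Q : Subgroup S} (φ : P →* Q) :
    P.map e.toMonoidHom →* Q.map e.toMonoidHom :=
  (mapEquiv e Q).toMonoidHom.comp (φ.comp (mapEquiv e P).symm.toMonoidHom)

theorem coe_transportHom (e : S ≃* T) {P Q : Subgroup S} (φ : P →* Q)
    (x : P.map e.toMonoidHom) :
    (transportHom e φ x : T) = e (φ ((mapEquiv e P).symm x)) := rfl

theorem transportHom_apply (e : S ≃* T) {P Q : Subgroup S} (φ : P →* Q) (x : P) :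
    (transportHom e φ (mapEquiv e P x) : T) = e (φ x) := by
  rw [coe_transportHom, MulEquiv.symm_apply_apply]

/-- The pullback of a fusion system along an isomorphism of groups. -/
def pullback (e : S ≃* T) (F : FusionSystem T) : FusionSystem S where
  Hom P Q := {φ | transportHom e φ ∈ F.Hom _ _}
  injective P Q φ hφ x y hxy := by
    refine (mapEquiv e P).injective (F.injective _ _ _ hφ (Subtype.ext ?_))
    rw [transportHom_apply, transportHom_apply, hxy]
  inner P Q φ s h := by
    refine F.inner _ _ _ (e s) fun x => ?_
    obtain ⟨x, rfl⟩ := (mapEquiv e P).surjective x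
    rw [transportHom_apply, h, map_mul, map_mul, map_inv, coe_mapEquiv]
  comp P Q R φ hφ ψ hψ := by
    have h : transportHom e (ψ.comp φ) = (transportHom e ψ).comp (transportHom e φ) := by
      ext x
      obtain ⟨x, rfl⟩ := (mapEquiv e P).surjective x
      have h1 : transportHom e φ (mapEquiv e P x) = mapEquiv e Q (φ x) :=
        Subtype.ext (transportHom_apply e φ x)
      rw [MonoidHom.comp_apply, h1, transportHom_apply, transportHom_apply]
      rfl
    rw [Set.mem_ofPred_eq, h]
    exact F.comp _ _ _ _ hφ _ hψ
  iso P Q R φ hφ ψ h := by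
    refine F.iso _ _ _ _ hφ ((mapEquiv e P).symm.trans (ψ.trans (mapEquiv e R)))
      fun x => ?_
    rw [coe_transportHom, ← h]
    rfl

theorem mem_hom_of_coe_eq (F : FusionSystem S) {P Q P' Q' : Subgroup S} (hP : P = P')
    (hQ : Q = Q') {φ : P →* Q} {ψ : P' →* Q'}
    (h : ∀ (x : P) (y : P'), (x : S) = y → (φ x : S) = ψ y) (hφ : φ ∈ F.Hom P Q) : ψ ∈ F.Hom P' Q' := by
  subst hP hQ
  rwa [show ψ = φ from MonoidHom.ext fun x => Subtype.ext (h x x rfl).symm]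

/-- An isomorphism of groups carries one fusion system to another if it and its inverse carry the
members of the generating families to each other. -/
theorem carriedBy_generate (e : S ≃* T) {X : ∀ P Q : Subgroup S, Set (P →* Q)}
    {Y : ∀ P Q : Subgroup T, Set (P →* Q)} (hX : ∀ P Q, ∀ φ ∈ X P Q, Function.Injective φ)
    (hY : ∀ P Q, ∀ ψ ∈ Y P Q, Function.Injective ψ)
    (hXY : ∀ P Q, ∀ φ ∈ X P Q, transportHom e φ ∈ Y _ _)
    (hYX : ∀ P Q, ∀ ψ ∈ Y P Q, transportHom e.symm ψ ∈ X _ _) :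
    CarriedBy e (generate X) (generate Y) := by
  intro P Q φ
  have hgX : ∀ P Q, X P Q ⊆ (generate X).Hom P Q := fun P Q φ h =>
    ⟨hX P Q φ h, fun F hF => hF P Q h⟩
  have hgY : ∀ P Q, Y P Q ⊆ (generate Y).Hom P Q := fun P Q φ h =>
    ⟨hY P Q φ h, fun F hF => hF P Q h⟩
  refine ⟨fun h => h.2 (pullback e (generate Y)) fun P Q φ h => hgY _ _ (hXY P Q φ h),
    fun h => ?_⟩
  have h1 : transportHom e.symm (transportHom e φ) ∈ (generate X).Hom _ _ :=
    h.2 (pullback e.symm (generate X)) fun P Q φ h => hgX _ _ (hYX P Q φ h)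
  have hmap : ∀ P : Subgroup S, (P.map e.toMonoidHom).map e.symm.toMonoidHom = P := fun P => by
    ext x
    simp [Subgroup.mem_map]
  refine mem_hom_of_coe_eq _ (hmap P) (hmap Q) (fun x y hxy => ?_) h1
  obtain ⟨x, rfl⟩ := (mapEquiv e.symm _).surjective x
  obtain ⟨x, rfl⟩ := (mapEquiv e P).surjective x
  rw [transportHom_apply, transportHom_apply, MulEquiv.symm_apply_apply]
  have : x = y := by
    rw [coe_mapEquiv, coe_mapEquiv, MulEquiv.symm_apply_apply] at hxy
    exact Subtype.ext hxy
  rw [this]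

end FusionSystem

namespace Locality

open PartialGroup

variable {p : ℕ} {L : Type*} {𝓛 : Locality p L}

theorem injective_of_conj {P Q : Subgroup 𝓛.S} {φ : P →* Q} {g : L}
    (h : ∀ x : P, ((φ x).1.1 : L) ∈ 𝓛.conj g x.1.1) : Function.Injective φ := fun x y hxy =>
  Subtype.ext <| Subtype.ext <| Part.mem_unique (conj_inv (h x)) (by
    rw [hxy]
    exact conj_inv (h y))

namespace SignalizerFunctor

variable [Fact p.Prime] (𝓣 : 𝓛.SignalizerFunctor)

/-- The restriction of the natural map to `S`. -/
noncomputable def projS : 𝓛.S ≃* 𝓣.quotientLocality.S where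
  toEquiv := Equiv.Set.imageOfInjOn 𝓣.proj 𝓛.S proj_injOn
  map_mul' x y := by
    refine Subtype.ext (Part.mem_unique (proj_isHom 𝓣 _ _
      (S_isSubgroup.coe_mul_mem x y)) ?_)
    exact (S_isSubgroup (𝓛 := 𝓣.quotientLocality)).coe_mul_mem ⟨_, x.1, x.2, rfl⟩ ⟨_, y.1, y.2, rfl⟩

theorem coe_projS (s : 𝓛.S) : (𝓣.projS s).1 = 𝓣.proj s.1 := rfl

theorem carriedBy_projS :
    FusionSystem.CarriedBy 𝓣.projS 𝓛.fusionSystem 𝓣.quotientLocality.fusionSystem := by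
  refine FusionSystem.carriedBy_generate _ (fun P Q φ ⟨g, h⟩ => injective_of_conj h)
    (fun P Q φ ⟨g, h⟩ => injective_of_conj h) ?_ ?_
  · rintro P Q φ ⟨g, h⟩
    refine ⟨𝓣.proj g, fun x => ?_⟩
    obtain ⟨x, rfl⟩ := (FusionSystem.mapEquiv 𝓣.projS P).surjective x
    rw [FusionSystem.transportHom_apply]
    exact (proj_isHom 𝓣).map_conj (h x)
  · rintro P Q ψ ⟨C, h⟩
    refine ⟨𝓣.rep C, fun x => ?_⟩
    obtain ⟨x, rfl⟩ := (FusionSystem.mapEquiv 𝓣.projS.symm P).surjective x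
    rw [FusionSystem.transportHom_apply]
    refine conj_rep (Subtype.prop _) (Subtype.prop _) ?_
    rw [← coe_projS, ← coe_projS]
    have h1 := h x
    rw [← 𝓣.projS.apply_symm_apply (ψ x).1, ← 𝓣.projS.apply_symm_apply x.1] at h1
    exact h1

/-! ### Normalizers of objects -/

variable (P : 𝓛.Δ) (P' : 𝓣.quotientLocality.Δ) (h : P'.1 = 𝓣.proj '' P.1)

/-- The natural map restricts to a homomorphism between the normalizers of corresponding
objects. -/
noncomputable def projNormalizer : 𝓛.normalizer P.1 →* 𝓣.quotientLocality.normalizer P'.1 :=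
  MonoidHom.mk' (fun x => ⟨𝓣.proj x.1, by
    rw [h]
    exact (proj_isHom 𝓣).map_conjEq x.2⟩) fun x y => by
    refine Subtype.ext (Part.mem_unique (proj_isHom 𝓣 _ _
      ((𝓛.normalizer_isSubgroup P.2).coe_mul_mem x y)) ?_)
    exact (𝓣.quotientLocality.normalizer_isSubgroup P'.2).coe_mul_mem ⟨𝓣.proj x.1, _⟩
      ⟨𝓣.proj y.1, _⟩

theorem coe_projNormalizer (x : 𝓛.normalizer P.1) :
    (𝓣.projNormalizer P P' h x).1 = 𝓣.proj x.1 := rfl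

theorem projNormalizer_surjective : Function.Surjective (𝓣.projNormalizer P P' h) := by
  rintro ⟨C, hC⟩
  rw [h] at hC
  have hPS := (𝓛.Δ_subgroup P.1 P.2).2
  exact ⟨⟨𝓣.rep C, conjEq_rep hPS hPS hC⟩, Subtype.ext (proj_rep C)⟩

theorem ker_projNormalizer : (𝓣.projNormalizer P P' h).ker = 𝓣.Θ P := by
  ext x
  have hone : 𝓣.proj 𝓛.one = 𝓣.quotientLocality.one := (proj_isHom 𝓣).map_one
  let n : (⟨P⟩ : 𝓛.Obj) ⟶ ⟨P⟩ := homMk x.1 x.2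
  have h1 : x ∈ 𝓣.Θ P ↔ 𝓣.Agree ⟨P⟩ x.1 𝓛.one := by
    rw [agree_one_iff]
    constructor
    · exact fun hx => ⟨n, hx, rfl⟩
    · rintro ⟨m, hm, hmx⟩
      obtain rfl : m = n := el_injective hmx
      exact hm
  rw [h1, MonoidHom.mem_ker]
  constructor
  · intro hx
    have h2 : 𝓣.proj x.1 = 𝓣.proj 𝓛.one := by
      rw [hone, ← coe_projNormalizer 𝓣 P P' h, hx]
      rfl
    refine agree_of_proj_eq h2 (subset_source_el n) ?_
    rw [source_eq_S S_isSubgroup.one_mem]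
    exact Obj.subset_S _
  · intro hx
    refine Subtype.ext ?_
    rw [coe_projNormalizer, hx.sim.proj_eq, hone]
    rfl

end SignalizerFunctor

end Locality

theorem proposition2p15 {p : ℕ} [Fact p.Prime] {L : Type*} (𝓛 : Locality p L)
    (𝓣 : 𝓛.SignalizerFunctor) :
    𝓛.IsPartialNormalPPrime 𝓣.union ∧
    ∃ ρ : L → 𝓛.Quotient 𝓣.union, 𝓛.IsNaturalMap 𝓣.union ρ ∧
    ∃ 𝓠 : Locality p (𝓛.Quotient 𝓣.union),
      -- the partial group structure of the quotient is the one that makes `ρ` a projection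
      𝓛.IsProjection 𝓠.toPartialGroup ρ ∧
      (∀ 𝓠' : PartialGroup (𝓛.Quotient 𝓣.union),
        𝓛.IsProjection 𝓠' ρ → 𝓠' = 𝓠.toPartialGroup) ∧
      -- its Sylow subgroup and its objects are the images of `S` and of the members of `Δ`
      𝓠.S = ρ '' 𝓛.S ∧
      𝓠.Δ = (fun P => ρ '' P) '' 𝓛.Δ ∧
      -- `ρ` restricts to an isomorphism from `S` to its image, under which the fusion systems agree
      (∃ e : 𝓛.S ≃* 𝓠.S, (∀ s, (e s).1 = ρ s.1) ∧
        FusionSystem.CarriedBy e 𝓛.fusionSystem 𝓠.fusionSystem) ∧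
      ∀ (P : 𝓛.Δ) (P' : 𝓠.Δ), P'.1 = ρ '' P.1 →
        ∃ f : 𝓛.normalizer P.1 →* 𝓠.normalizer P'.1, (∀ x, (f x).1 = ρ x.1) ∧
          f.ker = 𝓣.Θ P ∧
          ∃ ψ : (𝓛.normalizer P.1 ⧸ 𝓣.Θ P) ≃* 𝓠.normalizer P'.1,
            ∀ x : 𝓛.normalizer P.1, ψ (QuotientGroup.mk x) = f x := by
  refine ⟨𝓣.union_isPartialNormalPPrime, 𝓣.proj, 𝓣.proj_isNaturalMap, 𝓣.quotientLocality,
    𝓣.proj_isProjection,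
    fun 𝓠' h => h.unique 𝓣.proj_isProjection Locality.SignalizerFunctor.proj_surjective,
    rfl, rfl, ⟨𝓣.projS, 𝓣.coe_projS, 𝓣.carriedBy_projS⟩, fun P P' h => ?_⟩
  have hker := 𝓣.ker_projNormalizer P P' h
  exact ⟨𝓣.projNormalizer P P' h, 𝓣.coe_projNormalizer P P' h, hker,
    (QuotientGroup.quotientMulEquivOfEq hker.symm).trans
      (QuotientGroup.quotientKerEquivOfSurjective _ (𝓣.projNormalizer_surjective P P' h)),
    fun x => rfl⟩
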